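/- Let $n\ge 3$ and let $G$ be an $n$-dimensional Lie group with Lie algebra $\mathfrak g$ such that every left-invariant Riemannian metric on $G$ has non-positive scalar curvature (for $n=3$ and $G$ simply connected these are the groups of Bianchi types I–VIII). Let $\xi,\lambda,\kappa>0$ and $V(x)=\lambda e^{-\kappa x}$. On $I=[t_0,\infty)$ let $\gamma$ be a $C^2$ family of Riemannian metrics on $\mathfrak g$, $\phi\in C^2(I)$, and let $\rho$ (a function), $j$ (a covector on $\mathfrak g$) and $S$ (a symmetric two-tensor on $\mathfrak g$) be of class $C^1$ in $t\in I$. On $M=G\times I$, extending tensors on $\mathfrak g$ left-invariantly, put $g=\gamma-dt\otimes dt$ and $T=S-j\otimes dt-dt\otimes j+\rho\,dt\otimes dt$, and assume that the curvature-coupled Einstein–scalar field–matter equations hold: $$(1-\xi\phi^2)\bigl(\mathrm{Rc}_g-\tfrac12R_g\,g\bigr)=(1-2\xi)\nabla\phi\otimes\nabla\phi+\bigl(2\xi-\tfrac12\bigr)|\nabla\phi|_g^2\,g-2\xi\phi\nabla^2\phi+2\xi(\phi\,\Box_g\phi)\,g-V(\phi)\,g+T,$$ $$\Box_g\phi-\xi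 R_g\phi-V'(\phi)=0,\qquad \operatorname{div}_gT=0 .$$ Assume the energy conditions (DEC) $|j|_\gamma\le\rho$, $|\mathrm{tr}_\gamma S|\le n\rho$ and (SEC) $\rho+\mathrm{tr}_\gamma S\ge0$ on $I$. Let $k=-\tfrac12\dot\gamma$, $H=-\tfrac1n\mathrm{tr}_\gamma k$, $\sigma=k+H\gamma$ (the shear), $q=-1-\dot H/H^2$ and $\Omega=(1-\xi\phi^2)^{1/(n-1)}$. Suppose that at the initial time $1-\xi\phi(t_0)^2>0$ and $H(t_0)>-(\ln\Omega)\dot{}\,(t_0)$. Set $$\phi_\infty=\sqrt{\frac1\xi+\frac1{\kappa^2}\Bigl(\frac{n+1}{n-1}\Bigr)^2}-\frac1\kappa\,\frac{n+1}{n-1},\qquad H_\infty=\sqrt{\frac{2}{n(n-1)}\,\frac{V(\phi_\infty)}{1-\xi\phi_\infty^2}} .$$ Then $1-\xi\phi^2>0$ on all of $I$, $1-\xi\phi_\infty^2>0$, $H_\infty>0$, and as $t\to\infty$ $$\phi\to\phi_\infty,\quad\dot\phi\to0,\quad\ddot\phi\to0,\quad H\to H_\infty,\quad q\to-1;$$ moreover,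 for every $\delta>0$, the scalar curvature $R_\gamma$ of $\gamma(t)$ and $|\sigma|_\gamma^2$, $\rho$, $|j|_\gamma$, $\mathrm{tr}_\gamma S$ are all $O\bigl(e^{-(2-\delta)H_\infty t}\bigr)$. -/

import Mathlib

open Set Filter Topology Asymptotics Matrix

noncomputable section

namespace BianchiESM

/-! ### Curvature of invariant metrics in a left-invariant frame

All geometric objects are invariant under the group, so they are given by their components in a
left-invariant frame, and these components are functions of a real parameter `t` only. -/

/-- The data of a moving frame `(e_a)` that enter the computation of curvature of a metric whose
components depend on `t` only: the constants `c a b d` with `[e_a, e_b] = ∑ d, c a b d • e_d`, and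
the action `D a` of the vector field `e_a`, as a derivation, on functions of `t`. -/
structure Frame (A : Type*) where
  c : A → A → A → ℝ
  D : A → (ℝ → ℝ) → ℝ → ℝ

namespace Frame

variable {A : Type*} [Fintype A] [DecidableEq A] (F : Frame A) (g : ℝ → Matrix A A ℝ)

/-- Connection coefficients `∇_{e_a} e_b = ∑ d, Γ a b d • e_d` of the Levi-Civita connection of
`g`, by the Koszul formula
`2 g(∇_X Y, Z) = X g(Y,Z) + Y g(X,Z) - Z g(X,Y) + g([X,Y],Z) - g([X,Z],Y) - g([Y,Z],X)`. -/
def conn (a b d : A) (t : ℝ) : ℝ :=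
  ∑ e, (g t)⁻¹ d e * ((1 / 2) *
    (F.D a (fun s => g s b e) t + F.D b (fun s => g s a e) t - F.D e (fun s => g s a b) t
      + ∑ f, (F.c a b f * g t f e - F.c a e f * g t f b - F.c b e f * g t f a)))

/-- The `e_d`-component of
`R(e_a, e_b) e_k = ∇_{e_a} ∇_{e_b} e_k - ∇_{e_b} ∇_{e_a} e_k - ∇_{[e_a, e_b]} e_k`. -/
def riemann (a b k d : A) (t : ℝ) : ℝ :=
  F.D a (F.conn g b k d) t - F.D b (F.conn g a k d) t
    + ∑ f, (F.conn g b k f t * F.conn g a f d t - F.conn g a k f t * F.conn g b f d t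
      - F.c a b f * F.conn g f k d t)

/-- Ricci tensor: the trace of `X ↦ R(X, e_b) e_k`. -/
def ricci (b k : A) (t : ℝ) : ℝ := ∑ a, F.riemann g a b k a t

/-- Scalar curvature. -/
def scalarCurv (t : ℝ) : ℝ := ∑ a, ∑ b, (g t)⁻¹ a b * F.ricci g a b t

/-- Components of the differential of a function of `t`. -/
def grad (φ : ℝ → ℝ) (a : A) (t : ℝ) : ℝ := F.D a φ t

/-- `|∇φ|²` with respect to `g`. -/
def gradSq (φ : ℝ → ℝ) (t : ℝ) : ℝ :=
  ∑ a, ∑ b, (g t)⁻¹ a b * F.grad φ a t * F.grad φ b t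

/-- Second covariant derivative (Hessian) of a function of `t`. -/
def hess (φ : ℝ → ℝ) (a b : A) (t : ℝ) : ℝ :=
  F.D a (F.grad φ b) t - ∑ d, F.conn g a b d t * F.grad φ d t

/-- The wave operator (metric trace of the Hessian). -/
def box (φ : ℝ → ℝ) (t : ℝ) : ℝ := ∑ a, ∑ b, (g t)⁻¹ a b * F.hess g φ a b t

/-- Covariant derivative `(∇_{e_a} T)(e_b, e_d)` of a covariant two-tensor. -/
def covDeriv (T : ℝ → Matrix A A ℝ) (a b d : A) (t : ℝ) : ℝ :=
  F.D a (fun s => T s b d) t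
    - ∑ f, (F.conn g a b f t * T t f d + F.conn g a d f t * T t b f)

/-- Divergence of a covariant two-tensor. -/
def divergence (T : ℝ → Matrix A A ℝ) (d : A) (t : ℝ) : ℝ :=
  ∑ a, ∑ b, (g t)⁻¹ a b * F.covDeriv g T a b d t

end Frame

section LieAlgebra

variable {n : ℕ} {𝔤 : Type*} [LieRing 𝔤] [LieAlgebra ℝ 𝔤] (b : Module.Basis (Fin n) ℝ 𝔤)

/-- The frame of left-invariant vector fields on the group `G` given by a basis of its Lie
algebra. Components of left-invariant tensors are constant on `G`, so the frame annihilates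
them. -/
def leftFrame : Frame (Fin n) where
  c i j k := b.repr ⁅b i, b j⁆ k
  D _ _ _ := 0

/-- Scalar curvature of the left-invariant metric on `G` with matrix `h` in the basis `b`. -/
def groupScalarCurv (h : Matrix (Fin n) (Fin n) ℝ) : ℝ :=
  (leftFrame b).scalarCurv (fun _ => h) 0

/-- The frame `(∂_t, e_1, …, e_n)` on the space-time `G × I`: the `e_i` are left-invariant fields
on `G`, commute with `∂_t`, and annihilate functions of `t`. The derivative is taken within `I`,
hence is one-sided at an end point. -/
def spacetimeFrame (I : Set ℝ) : Frame (Unit ⊕ Fin n) where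
  c
    | .inr i, .inr j, .inr k => b.repr ⁅b i, b j⁆ k
    | _, _, _ => 0
  D
    | .inl _, f, t => derivWithin f I t
    | .inr _, _, _ => 0

end LieAlgebra

variable {n : ℕ}

/-- The Lorentzian metric `γ - dt ⊗ dt` on `G × I`. -/
def spacetimeMetric (γ : ℝ → Matrix (Fin n) (Fin n) ℝ) (t : ℝ) :
    Matrix (Unit ⊕ Fin n) (Unit ⊕ Fin n) ℝ :=
  fromBlocks (-1) 0 0 (γ t)

/-- The energy-momentum tensor `S - j ⊗ dt - dt ⊗ j + ρ dt ⊗ dt` on `G × I`. -/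
def stressEnergy (ρ : ℝ → ℝ) (j : ℝ → Fin n → ℝ) (S : ℝ → Matrix (Fin n) (Fin n) ℝ) (t : ℝ) :
    Matrix (Unit ⊕ Fin n) (Unit ⊕ Fin n) ℝ :=
  fromBlocks (of fun _ _ => ρ t) (of fun _ i => -j t i) (of fun i _ => -j t i) (S t)

/-! ### Geometry of the slices -/

/-- `k = -(1/2) dγ/dt`; the second fundamental form of a slice is `-k ∂_t`. -/
def secondForm (I : Set ℝ) (γ : ℝ → Matrix (Fin n) (Fin n) ℝ) (t : ℝ) :
    Matrix (Fin n) (Fin n) ℝ :=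
  fun i l => -(1 / 2) * derivWithin (fun s => γ s i l) I t

/-- Trace of a covariant two-tensor `S` with respect to the metric `h`. -/
def metricTrace (h S : Matrix (Fin n) (Fin n) ℝ) : ℝ := (h⁻¹ * S).trace

/-- The Hubble parameter (negative mean curvature) `H = -(tr k) / n`. -/
def hubble (I : Set ℝ) (γ : ℝ → Matrix (Fin n) (Fin n) ℝ) (t : ℝ) : ℝ :=
  -metricTrace (γ t) (secondForm I γ t) / n

/-- The shear tensor `σ = k + H γ`. -/
def shear (I : Set ℝ) (γ : ℝ → Matrix (Fin n) (Fin n) ℝ) (t : ℝ) :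
    Matrix (Fin n) (Fin n) ℝ :=
  secondForm I γ t + hubble I γ t • γ t

/-- Squared norm of a covariant two-tensor with respect to the metric `h`. -/
def tensorNormSq (h A : Matrix (Fin n) (Fin n) ℝ) : ℝ :=
  ∑ i, ∑ k, ∑ l, ∑ m, h⁻¹ i k * h⁻¹ l m * A i l * A k m

/-- Norm of a covector with respect to the metric `h`. -/
def covectorNorm (h : Matrix (Fin n) (Fin n) ℝ) (w : Fin n → ℝ) : ℝ :=
  Real.sqrt (∑ i, ∑ k, h⁻¹ i k * w i * w k)

/-- The deceleration parameter `q = -1 - (dH/dt) / H²`. -/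
def deceleration (I : Set ℝ) (γ : ℝ → Matrix (Fin n) (Fin n) ℝ) (t : ℝ) : ℝ :=
  -1 - derivWithin (hubble I γ) I t / hubble I γ t ^ 2

/-! ### The curvature-coupled Einstein-scalar field-matter system -/

/-- A spatially homogeneous solution, on the time interval `I`, of the Einstein-scalar field-matter
equations with scalar field `φ` coupled to the scalar curvature with coupling constant `ξ` and
potential `V`. -/
structure IsCoupledSolution {𝔤 : Type*} [LieRing 𝔤] [LieAlgebra ℝ 𝔤]
    (b : Module.Basis (Fin n) ℝ 𝔤) (I : Set ℝ) (ξ : ℝ) (V : ℝ → ℝ)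
    (γ : ℝ → Matrix (Fin n) (Fin n) ℝ) (φ ρ : ℝ → ℝ) (j : ℝ → Fin n → ℝ)
    (S : ℝ → Matrix (Fin n) (Fin n) ℝ) : Prop where
  contDiff_metric : ∀ i k, ContDiffOn ℝ 2 (fun t => γ t i k) I
  contDiff_field : ContDiffOn ℝ 2 φ I
  contDiff_density : ContDiffOn ℝ 1 ρ I
  contDiff_flow : ∀ i, ContDiffOn ℝ 1 (fun t => j t i) I
  contDiff_pressure : ∀ i k, ContDiffOn ℝ 1 (fun t => S t i k) I
  posDef_metric : ∀ t ∈ I, (γ t).PosDef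
  symm_pressure : ∀ t ∈ I, (S t).IsSymm
  einstein : ∀ t ∈ I, ∀ x y,
    let F := spacetimeFrame b I
    let g := spacetimeMetric γ
    (1 - ξ * φ t ^ 2) * (F.ricci g x y t - 1 / 2 * F.scalarCurv g t * g t x y) =
      (1 - 2 * ξ) * (F.grad φ x t * F.grad φ y t)
        + (2 * ξ - 1 / 2) * F.gradSq g φ t * g t x y
        - 2 * ξ * φ t * F.hess g φ x y t
        + 2 * ξ * (φ t * F.box g φ t) * g t x y
        - V (φ t) * g t x y
        + stressEnergy ρ j S t x y
  field : ∀ t ∈ I,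
    let F := spacetimeFrame b I
    let g := spacetimeMetric γ
    F.box g φ t - ξ * F.scalarCurv g t * φ t - deriv V (φ t) = 0
  matter : ∀ t ∈ I, ∀ x,
    (spacetimeFrame b I).divergence (spacetimeMetric γ) (stressEnergy ρ j S) x t = 0

/-- Dominant energy condition for matter with density `ρ`, flow `j` and pressure `S`. -/
def DominantEnergy (γ : Matrix (Fin n) (Fin n) ℝ) (ρ : ℝ) (j : Fin n → ℝ)
    (S : Matrix (Fin n) (Fin n) ℝ) : Prop :=
  covectorNorm γ j ≤ ρ ∧ |metricTrace γ S| ≤ n * ρ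

/-- Strong energy condition for matter with density `ρ` and pressure `S`. -/
def StrongEnergy (γ : Matrix (Fin n) (Fin n) ℝ) (ρ : ℝ) (S : Matrix (Fin n) (Fin n) ℝ) : Prop :=
  0 ≤ ρ + metricTrace γ S

/-- The exponential potential `x ↦ lam * exp (-κ x)`. -/
def expPotential (lam κ x : ℝ) : ℝ := lam * Real.exp (-κ * x)

/-- The conformal factor `Ω = (1 - ξ φ²) ^ (1 / (n - 1))`. -/
def conformalFactor (n : ℕ) (ξ : ℝ) (φ : ℝ → ℝ) (t : ℝ) : ℝ :=
  (1 - ξ * φ t ^ 2) ^ (1 / ((n : ℝ) - 1))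

/-- The limit `φ_∞` of the scalar field. -/
def fieldLimit (n : ℕ) (ξ κ : ℝ) : ℝ :=
  Real.sqrt (1 / ξ + 1 / κ ^ 2 * (((n : ℝ) + 1) / ((n : ℝ) - 1)) ^ 2)
    - 1 / κ * (((n : ℝ) + 1) / ((n : ℝ) - 1))

/-- The limit `H_∞` of the Hubble parameter. -/
def hubbleLimit (n : ℕ) (ξ lam κ : ℝ) : ℝ :=
  Real.sqrt (2 / ((n : ℝ) * ((n : ℝ) - 1)) *
    (expPotential lam κ (fieldLimit n ξ κ) / (1 - ξ * fieldLimit n ξ κ ^ 2)))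

end BianchiESM

end

/-! The proof works in the Einstein frame, obtained by the conformal change with factor `Ω`. Write u
= 1 - ξφ², ω for the logarithmic derivative of `Ω` (`conformalRate`), and P = H + ω, so that P/Ω is
the Hubble parameter of the conformal metric. In these variables the coupling becomes minimal. The
Hamiltonian constraint reads n(n-1)/2 · P² = kinetic term + V/u + W, where W = ρ/u + |σ|²/2 - R_γ/2
(`anisoEnergy`) and every term on the right is non-negative (`hamiltonian_conformal`). The function
L = log P - (log u)/(n-1) = log(P/Ω) is non-increasing, with L' ≤ -φ'²/((n-1)P) (`hasDeriv_log`,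
`sq_le_dissipation`).

Positivity of u is a continuation argument. While u > 0, the constraint keeps P away from 0,
monotonicity of L bounds P by a multiple of u^(1/(n-1)), and V is bounded below because |φ| ≤ 1/√ξ.
The constraint then bounds u below by a constant depending only on the parameters and the initial
data (`exists_u_ge`, `u_pos`).

Now P and u lie between positive constants. Differentiating the constraint gives W' ≤ (-2P + C|φ'|)W
(`exists_anisoEnergy_deriv_le`). Since φ'² is controlled by -L' and L is bounded, Gronwall's
inequality gives W → 0 (`tendsto_anisoEnergy`). Barbalat's lemma applied to L gives φ' → 0
(`tendsto_y`). Applied to a weighted momentum of the field and to its negative, it makes the slope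
of the Einstein-frame potential tend to 0 (`tendsto_potSlope`). This slope has only one zero
compatible with u > 0, namely φ_∞ (`tendsto_x`). The constraint then yields H → H_∞, and a second
use of Gronwall, with -2P + C|φ'| → -2H_∞, gives the decay rate for W, which dominates all the
quantities to be estimated (`anisoEnergy_isBigO`). -/

noncomputable section

namespace BianchiESM

/-! ### Curvature of `G × I` in terms of the slices. -/

section Geometry

variable {n : ℕ} {𝔤 : Type*} [LieRing 𝔤] [LieAlgebra ℝ 𝔤] (b : Module.Basis (Fin n) ℝ 𝔤)

theorem inv_spacetimeMetric {γ : ℝ → Matrix (Fin n) (Fin n) ℝ} {t : ℝ} (h : IsUnit (γ t).det) :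
    (spacetimeMetric γ t)⁻¹ = fromBlocks (-1) 0 0 (γ t)⁻¹ := by
  apply Matrix.inv_eq_right_inv
  simp [spacetimeMetric, fromBlocks_multiply, Matrix.mul_nonsing_inv _ h]

@[simp] theorem spacetimeFrame_D_inl (I : Set ℝ) (f : ℝ → ℝ) (t : ℝ) :
    (spacetimeFrame b I).D (.inl ()) f t = derivWithin f I t := rfl

@[simp] theorem spacetimeFrame_D_inr (I : Set ℝ) (i : Fin n) (f : ℝ → ℝ) (t : ℝ) :
    (spacetimeFrame b I).D (.inr i) f t = 0 := rfl

@[simp] theorem spacetimeFrame_c_inl_left (I : Set ℝ) (x y : Unit ⊕ Fin n) :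
    (spacetimeFrame b I).c (.inl ()) x y = 0 := rfl

@[simp] theorem spacetimeFrame_c_inl_mid (I : Set ℝ) (x y : Unit ⊕ Fin n) :
    (spacetimeFrame b I).c x (.inl ()) y = 0 := by cases x <;> rfl

@[simp] theorem spacetimeFrame_c_inl_right (I : Set ℝ) (x y : Unit ⊕ Fin n) :
    (spacetimeFrame b I).c x y (.inl ()) = 0 := by cases x <;> cases y <;> rfl

@[simp] theorem spacetimeFrame_c_inr (I : Set ℝ) (i l m : Fin n) :
    (spacetimeFrame b I).c (.inr i) (.inr l) (.inr m) = (leftFrame b).c i l m := rfl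

variable {I : Set ℝ} {γ : ℝ → Matrix (Fin n) (Fin n) ℝ} {t : ℝ}

theorem conn_inl_inl (h : IsUnit (γ t).det) (d : Unit ⊕ Fin n) :
    (spacetimeFrame b I).conn (spacetimeMetric γ) (.inl ()) (.inl ()) d t = 0 := by
  cases d <;> simp only [Frame.conn, inv_spacetimeMetric h] <;> simp [ spacetimeFrame, spacetimeMetric]

theorem conn_inl_inr_inl (h : IsUnit (γ t).det) (i : Fin n) :
    (spacetimeFrame b I).conn (spacetimeMetric γ) (.inl ()) (.inr i) (.inl ()) t = 0 := by
  simp only [Frame.conn, inv_spacetimeMetric h]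
  simp [ spacetimeFrame, spacetimeMetric]

theorem conn_inr_inl_inl (h : IsUnit (γ t).det) (i : Fin n) :
    (spacetimeFrame b I).conn (spacetimeMetric γ) (.inr i) (.inl ()) (.inl ()) t = 0 := by
  simp only [Frame.conn, inv_spacetimeMetric h]
  simp [ spacetimeFrame, spacetimeMetric]

theorem conn_inl_inr_inr (h : IsUnit (γ t).det) (i l : Fin n) :
    (spacetimeFrame b I).conn (spacetimeMetric γ) (.inl ()) (.inr i) (.inr l) t
      = -((γ t)⁻¹ * (secondForm I γ t)ᵀ) l i := by
  simp only [Frame.conn, inv_spacetimeMetric h]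
  simp [ spacetimeFrame, spacetimeMetric, secondForm, Matrix.mul_apply]

theorem conn_inr_inl_inr (h : IsUnit (γ t).det) (i l : Fin n) :
    (spacetimeFrame b I).conn (spacetimeMetric γ) (.inr i) (.inl ()) (.inr l) t
      = -((γ t)⁻¹ * (secondForm I γ t)ᵀ) l i := by
  simp only [Frame.conn, inv_spacetimeMetric h]
  simp [ spacetimeFrame, spacetimeMetric, secondForm, Matrix.mul_apply]

theorem conn_inr_inr_inl (h : IsUnit (γ t).det) (i l : Fin n) :
    (spacetimeFrame b I).conn (spacetimeMetric γ) (.inr i) (.inr l) (.inl ()) t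
      = -secondForm I γ t i l := by
  simp only [Frame.conn, inv_spacetimeMetric h]
  simp [ spacetimeFrame, spacetimeMetric, secondForm]

theorem conn_inr_inr_inr (h : IsUnit (γ t).det) (i l m : Fin n) :
    (spacetimeFrame b I).conn (spacetimeMetric γ) (.inr i) (.inr l) (.inr m) t
      = (leftFrame b).conn (fun _ => γ t) i l m 0 := by
  simp only [Frame.conn, inv_spacetimeMetric h]
  simp [ spacetimeFrame, spacetimeMetric, leftFrame]

theorem hasDerivWithinAt_matrix_inv {γ' : Matrix (Fin n) (Fin n) ℝ} (h : IsUnit (γ t).det)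
    (hγ : ∀ i l, HasDerivWithinAt (fun s => γ s i l) (γ' i l) I t) (i l : Fin n) :
    HasDerivWithinAt (fun s => (γ s)⁻¹ i l) (-((γ t)⁻¹ * γ' * (γ t)⁻¹) i l) I t := by
  -- Any submultiplicative norm would do: it only serves to differentiate the ring inverse, and the
  -- result is then read off entrywise.
  let _ : NormedRing (Matrix (Fin n) (Fin n) ℝ) := Matrix.linftyOpNormedRing
  let _ : NormedAlgebra ℝ (Matrix (Fin n) (Fin n) ℝ) := Matrix.linftyOpNormedAlgebra
  have h1 : HasDerivWithinAt γ γ' I t :=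
    hasDerivWithinAt_pi.2 fun i => hasDerivWithinAt_pi.2 fun l => hγ i l
  obtain ⟨u, hu⟩ := (Matrix.isUnit_iff_isUnit_det _).2 h
  have h2 := hasFDerivAt_ringInverse (𝕜 := ℝ) u
  rw [hu] at h2
  have h3 := h2.comp_hasDerivWithinAt t h1
  have h4 := hasDerivWithinAt_pi.1 (hasDerivWithinAt_pi.1 h3 i) l
  have hu' : (↑u⁻¹ : Matrix (Fin n) (Fin n) ℝ) = (γ t)⁻¹ := by
    rw [← hu, Matrix.coe_units_inv]
  simpa [hu', Function.comp_def, ← Matrix.nonsing_inv_eq_ringInverse] using h4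

/-- The entries of `γ` are twice differentiable within `I`, and `γ` is a metric on `I`. -/
structure IsMetricCurve (I : Set ℝ) (γ : ℝ → Matrix (Fin n) (Fin n) ℝ) : Prop where
  uniqueDiffOn : UniqueDiffOn ℝ I
  differentiableOn : ∀ i l, DifferentiableOn ℝ (fun s => γ s i l) I
  differentiableOn_secondForm : ∀ i l, DifferentiableOn ℝ (fun s => secondForm I γ s i l) I
  posDef : ∀ t ∈ I, (γ t).PosDef

/-- The time derivative of the second fundamental form. -/
def secondFormDeriv (I : Set ℝ) (γ : ℝ → Matrix (Fin n) (Fin n) ℝ) (t : ℝ) :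
    Matrix (Fin n) (Fin n) ℝ :=
  fun i l => derivWithin (fun s => secondForm I γ s i l) I t

namespace IsMetricCurve

theorem isUnit_det (hγ : IsMetricCurve I γ) (ht : t ∈ I) : IsUnit (γ t).det :=
  (Matrix.isUnit_iff_isUnit_det _).1 (hγ.posDef t ht).isUnit

theorem isSymm (hγ : IsMetricCurve I γ) (ht : t ∈ I) : (γ t)ᵀ = γ t := by
  simpa [Matrix.IsHermitian] using (hγ.posDef t ht).1

theorem isSymm_inv (hγ : IsMetricCurve I γ) (ht : t ∈ I) : ((γ t)⁻¹)ᵀ = (γ t)⁻¹ := by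
  rw [Matrix.transpose_nonsing_inv, hγ.isSymm ht]

theorem isSymm_secondForm (hγ : IsMetricCurve I γ) (ht : t ∈ I) :
    (secondForm I γ t)ᵀ = secondForm I γ t := by
  ext i l
  simp only [transpose_apply, secondForm]
  congr 1
  refine derivWithin_congr (fun s hs => ?_) ?_
  · exact congr_fun (congr_fun (hγ.isSymm hs) i) l
  · exact congr_fun (congr_fun (hγ.isSymm ht) i) l

theorem isSymm_secondFormDeriv (hγ : IsMetricCurve I γ) (ht : t ∈ I) :
    (secondFormDeriv I γ t)ᵀ = secondFormDeriv I γ t := by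
  ext i l
  simp only [transpose_apply, secondFormDeriv]
  refine derivWithin_congr (fun s hs => ?_) ?_
  · exact congr_fun (congr_fun (hγ.isSymm_secondForm hs) i) l
  · exact congr_fun (congr_fun (hγ.isSymm_secondForm ht) i) l

theorem hasDerivWithinAt_metric (hγ : IsMetricCurve I γ) (ht : t ∈ I) (i l : Fin n) :
    HasDerivWithinAt (fun s => γ s i l) (((-2 : ℝ) • secondForm I γ t) i l) I t := by
  have := (hγ.differentiableOn i l t ht).hasDerivWithinAt
  have h : ((-2 : ℝ) • secondForm I γ t) i l = derivWithin (fun s => γ s i l) I t := by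
    simp [secondForm]
  rwa [h]

theorem hasDerivWithinAt_inv (hγ : IsMetricCurve I γ) (ht : t ∈ I) (i l : Fin n) :
    HasDerivWithinAt (fun s => (γ s)⁻¹ i l)
      (2 * ((γ t)⁻¹ * secondForm I γ t * (γ t)⁻¹) i l) I t := by
  convert hasDerivWithinAt_matrix_inv (hγ.isUnit_det ht) (hγ.hasDerivWithinAt_metric ht) i l
    using 1
  simp

theorem hasDerivWithinAt_secondForm (hγ : IsMetricCurve I γ) (ht : t ∈ I) (i l : Fin n) :
    HasDerivWithinAt (fun s => secondForm I γ s i l) (secondFormDeriv I γ t i l) I t :=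
  (hγ.differentiableOn_secondForm i l t ht).hasDerivWithinAt

theorem differentiableWithinAt_inv_mul (hγ : IsMetricCurve I γ) (ht : t ∈ I) (i l : Fin n) :
    DifferentiableWithinAt ℝ (fun s => ((γ s)⁻¹ * secondForm I γ s) i l) I t := by
  simp only [Matrix.mul_apply]
  exact DifferentiableWithinAt.fun_sum fun m _ =>
    (hγ.hasDerivWithinAt_inv ht i m).differentiableWithinAt.mul
      (hγ.differentiableOn_secondForm m l t ht)

theorem hasDerivWithinAt_metricTrace (hγ : IsMetricCurve I γ) (ht : t ∈ I) :
    HasDerivWithinAt (fun s => metricTrace (γ s) (secondForm I γ s))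
      (2 * ((γ t)⁻¹ * secondForm I γ t * (γ t)⁻¹ * secondForm I γ t).trace
        + ((γ t)⁻¹ * secondFormDeriv I γ t).trace) I t := by
  have h : ∀ A B : Matrix (Fin n) (Fin n) ℝ, (A * B).trace = ∑ i, ∑ l, A i l * B l i := by
    intro A B
    simp [Matrix.trace, Matrix.mul_apply]
  simp only [metricTrace, h _ (secondForm I γ _), h _ (secondFormDeriv I γ _)]
  rw [Finset.mul_sum, ← Finset.sum_add_distrib]
  refine HasDerivWithinAt.fun_sum fun i _ => ?_
  rw [Finset.mul_sum, ← Finset.sum_add_distrib]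
  refine HasDerivWithinAt.fun_sum fun l _ => ?_
  refine ((hγ.hasDerivWithinAt_inv ht i l).mul
    (hγ.hasDerivWithinAt_secondForm ht l i)).congr_deriv ?_
  ring

theorem ricci_inl_inl (hγ : IsMetricCurve I γ) (ht : t ∈ I) :
    (spacetimeFrame b I).ricci (spacetimeMetric γ) (.inl ()) (.inl ()) t
      = derivWithin (fun s => metricTrace (γ s) (secondForm I γ s)) I t
        - ((γ t)⁻¹ * secondForm I γ t * (γ t)⁻¹ * secondForm I γ t).trace := by
  have h := hγ.isUnit_det ht
  have hD : ∑ i : Fin n, derivWithin ((spacetimeFrame b I).conn (spacetimeMetric γ)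
      (.inr i) (.inl ()) (.inr i)) I t
      = -derivWithin (fun s => metricTrace (γ s) (secondForm I γ s)) I t := by
    simp only [metricTrace, Matrix.trace, diag_apply]
    rw [derivWithin_fun_sum fun i _ => hγ.differentiableWithinAt_inv_mul ht i i,
      ← Finset.sum_neg_distrib]
    refine Finset.sum_congr rfl fun i _ => ?_
    rw [← derivWithin.fun_neg]
    refine derivWithin_congr (fun s hs => ?_) ?_
    · rw [conn_inr_inl_inr b (hγ.isUnit_det hs), hγ.isSymm_secondForm hs]
    · rw [conn_inr_inl_inr b h, hγ.isSymm_secondForm ht]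
  simp only [Frame.ricci, Fintype.sum_sum_type, Finset.univ_unique, PUnit.default_eq_unit,
    Finset.sum_singleton, Frame.riemann]
  simp only [conn_inl_inl b h, conn_inr_inl_inl b h, conn_inr_inl_inr b h, conn_inl_inr_inr b h,
    hγ.isSymm_secondForm ht, spacetimeFrame_D_inl, spacetimeFrame_D_inr,
    spacetimeFrame_c_inl_mid, Finset.sum_add_distrib, Finset.sum_sub_distrib, hD]
  have hS : (∑ x, ∑ y, ((γ t)⁻¹ * secondForm I γ t) y x * ((γ t)⁻¹ * secondForm I γ t) x y)
      = ((γ t)⁻¹ * secondForm I γ t * (γ t)⁻¹ * secondForm I γ t).trace := by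
    rw [Matrix.mul_assoc _ (γ t)⁻¹, Matrix.trace]
    refine Finset.sum_congr rfl fun x _ => ?_
    rw [diag_apply, Matrix.mul_apply]
    exact Finset.sum_congr rfl fun y _ => mul_comm _ _
  simp [hS, sub_eq_add_neg]

/-- Connection coefficients with three spatial indices are those of the slice, so their products
assemble into the Ricci tensor of the slice; all other contributions are expressed through `k` and
its time derivative. -/
theorem ricci_inr_inr (hγ : IsMetricCurve I γ) (ht : t ∈ I) (i l : Fin n) :
    (spacetimeFrame b I).ricci (spacetimeMetric γ) (.inr i) (.inr l) t
      = ((leftFrame b).ricci (fun _ => γ t) i l 0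
        + (metricTrace (γ t) (secondForm I γ t) • secondForm I γ t - secondFormDeriv I γ t
        - (2 : ℝ) • (secondForm I γ t * (γ t)⁻¹ * secondForm I γ t)) i l) := by
  have h := hγ.isUnit_det ht
  have hD : derivWithin ((spacetimeFrame b I).conn (spacetimeMetric γ)
      (.inr i) (.inr l) (.inl ())) I t = -secondFormDeriv I γ t i l := by
    rw [secondFormDeriv, ← derivWithin.fun_neg]
    exact derivWithin_congr (fun s hs => conn_inr_inr_inl b (hγ.isUnit_det hs) i l)
      (conn_inr_inr_inl b h i l)
  have h0 : ∀ (a : Fin n) (f : ℝ → ℝ) (s : ℝ), (leftFrame b).D a f s = 0 := fun _ _ _ => rfl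
  simp only [Frame.ricci, Fintype.sum_sum_type, Finset.univ_unique, PUnit.default_eq_unit,
    Finset.sum_singleton, Frame.riemann]
  simp only [conn_inl_inl b h, conn_inr_inl_inl b h, conn_inr_inl_inr b h, conn_inl_inr_inr b h,
    conn_inl_inr_inl b h, conn_inr_inr_inl b h, conn_inr_inr_inr b h,
    hγ.isSymm_secondForm ht, spacetimeFrame_D_inl, spacetimeFrame_D_inr, spacetimeFrame_c_inl_left,
    spacetimeFrame_c_inl_right, spacetimeFrame_c_inr,
    Finset.sum_add_distrib, Finset.sum_sub_distrib, hD]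
  have h1 : ∑ x, ((γ t)⁻¹ * secondForm I γ t) x l * secondForm I γ t i x
      = (secondForm I γ t * (γ t)⁻¹ * secondForm I γ t) i l := by
    rw [Matrix.mul_assoc, Matrix.mul_apply (N := (γ t)⁻¹ * _)]
    exact Finset.sum_congr rfl fun _ _ => mul_comm _ _
  have h2 : ∑ x, secondForm I γ t x l * ((γ t)⁻¹ * secondForm I γ t) x i
      = (secondForm I γ t * (γ t)⁻¹ * secondForm I γ t) i l := by
    have h3 : secondForm I γ t * (γ t)⁻¹ = ((γ t)⁻¹ * secondForm I γ t)ᵀ := by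
      rw [transpose_mul, hγ.isSymm_inv ht, hγ.isSymm_secondForm ht]
    rw [h3, Matrix.mul_apply (M := ((γ t)⁻¹ * _)ᵀ)]
    exact Finset.sum_congr rfl fun _ _ => mul_comm _ _
  have h3 : ∑ x, secondForm I γ t i l * ((γ t)⁻¹ * secondForm I γ t) x x
      = metricTrace (γ t) (secondForm I γ t) * secondForm I γ t i l := by
    rw [← Finset.mul_sum, mul_comm]
    rfl
  simp [h0, h1, h2, h3]
  ring

theorem _root_.Matrix.sum_sum_mul_eq_trace (A B : Matrix (Fin n) (Fin n) ℝ) :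
    ∑ i, ∑ l, A i l * B i l = (A * Bᵀ).trace := by
  simp [Matrix.trace, Matrix.mul_apply]

/-- The trace does not commute with d/dt, because the derivative of γ⁻¹ is 2γ⁻¹kγ⁻¹. This correction
fixes the coefficient of |k|² in the scalar curvature of space-time. -/
theorem trace_inv_mul_secondFormDeriv (hγ : IsMetricCurve I γ) (ht : t ∈ I) :
    ((γ t)⁻¹ * secondFormDeriv I γ t).trace
      = derivWithin (fun s => metricTrace (γ s) (secondForm I γ s)) I t
        - 2 * ((γ t)⁻¹ * secondForm I γ t * (γ t)⁻¹ * secondForm I γ t).trace := by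
  rw [(hγ.hasDerivWithinAt_metricTrace ht).derivWithin (hγ.uniqueDiffOn t ht)]
  ring

theorem sum_inv_mul_inv (h : IsUnit (γ t).det)
    (f : Unit ⊕ Fin n → Unit ⊕ Fin n → ℝ) :
    ∑ x, ∑ y, (spacetimeMetric γ t)⁻¹ x y * f x y
      = -f (.inl ()) (.inl ()) + ∑ i, ∑ l, (γ t)⁻¹ i l * f (.inr i) (.inr l) := by
  rw [inv_spacetimeMetric h]
  simp

theorem scalarCurv_eq (hγ : IsMetricCurve I γ) (ht : t ∈ I) :
    (spacetimeFrame b I).scalarCurv (spacetimeMetric γ) t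
      = groupScalarCurv b (γ t)
        - 2 * derivWithin (fun s => metricTrace (γ s) (secondForm I γ s)) I t
        + metricTrace (γ t) (secondForm I γ t) ^ 2
        + ((γ t)⁻¹ * secondForm I γ t * (γ t)⁻¹ * secondForm I γ t).trace := by
  rw [Frame.scalarCurv, sum_inv_mul_inv (hγ.isUnit_det ht), ricci_inl_inl b hγ ht]
  simp only [ricci_inr_inr b hγ ht, mul_add, Finset.sum_add_distrib]
  rw [Matrix.sum_sum_mul_eq_trace, transpose_sub, transpose_sub, transpose_smul, transpose_smul,
    transpose_mul, transpose_mul, hγ.isSymm_inv ht, hγ.isSymm_secondForm ht,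
    hγ.isSymm_secondFormDeriv ht, mul_sub, mul_sub, trace_sub, trace_sub,
    hγ.trace_inv_mul_secondFormDeriv ht]
  simp only [Matrix.mul_smul, trace_smul, smul_eq_mul, ← Matrix.mul_assoc]
  change -_ + (groupScalarCurv b (γ t) + (_ * metricTrace (γ t) (secondForm I γ t) - _ - _)) = _
  ring

theorem box_eq (hγ : IsMetricCurve I γ) (ht : t ∈ I) (φ : ℝ → ℝ) :
    (spacetimeFrame b I).box (spacetimeMetric γ) φ t
      = -derivWithin (derivWithin φ I) I t
        + metricTrace (γ t) (secondForm I γ t) * derivWithin φ I t := by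
  have h := hγ.isUnit_det ht
  rw [Frame.box, sum_inv_mul_inv h]
  have h1 : ∀ i l, (spacetimeFrame b I).hess (spacetimeMetric γ) φ (.inr i) (.inr l) t
      = derivWithin φ I t * secondForm I γ t i l := by
    intro i l
    simp [Frame.hess, Frame.grad, conn_inr_inr_inl b h, mul_comm]
  have h2 : (spacetimeFrame b I).hess (spacetimeMetric γ) φ (.inl ()) (.inl ()) t
      = derivWithin (derivWithin φ I) I t := by
    simp [Frame.hess, Frame.grad, conn_inl_inl b h]
    rfl
  simp only [h1, h2, mul_left_comm _ (derivWithin φ I t), ← Finset.mul_sum]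
  rw [Matrix.sum_sum_mul_eq_trace, hγ.isSymm_secondForm ht, metricTrace, mul_comm]

theorem hess_inl_inl (h : IsUnit (γ t).det) (φ : ℝ → ℝ) :
    (spacetimeFrame b I).hess (spacetimeMetric γ) φ (.inl ()) (.inl ()) t
      = derivWithin (derivWithin φ I) I t := by
  simp [Frame.hess, Frame.grad, conn_inl_inl b h]
  rfl

theorem gradSq_eq (h : IsUnit (γ t).det) (φ : ℝ → ℝ) :
    (spacetimeFrame b I).gradSq (spacetimeMetric γ) φ t = -derivWithin φ I t ^ 2 := by
  simp only [Frame.gradSq, mul_assoc]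
  rw [sum_inv_mul_inv h]
  simp [Frame.grad, sq]

theorem tensorNormSq_eq_trace (h A : Matrix (Fin n) (Fin n) ℝ) (hh : hᵀ = h) :
    tensorNormSq h A = (h⁻¹ * A * h⁻¹ * Aᵀ).trace := by
  have hM : (h⁻¹)ᵀ = h⁻¹ := by rw [transpose_nonsing_inv, hh]
  have h1 : ∀ i k, (∑ l, ∑ m, h⁻¹ i k * h⁻¹ l m * A i l * A k m)
      = h⁻¹ i k * (A * h⁻¹ * Aᵀ) i k := by
    intro i k
    rw [Matrix.mul_apply, Finset.sum_comm]
    simp only [Matrix.mul_apply, Finset.mul_sum, Finset.sum_mul, transpose_apply]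
    exact Finset.sum_congr rfl fun _ _ => Finset.sum_congr rfl fun _ _ => by ring
  simp only [tensorNormSq, h1]
  rw [Matrix.sum_sum_mul_eq_trace, transpose_mul, transpose_mul, hM, transpose_transpose]
  simp only [Matrix.mul_assoc]

/-- Writing h⁻¹ = BᵀB turns the expression into the sum of squares of the entries of BABᵀ. -/
theorem tensorNormSq_nonneg {h : Matrix (Fin n) (Fin n) ℝ} (hh : h.PosDef)
    (A : Matrix (Fin n) (Fin n) ℝ) : 0 ≤ tensorNormSq h A := by
  rw [tensorNormSq_eq_trace _ _ (by simpa [Matrix.IsHermitian] using hh.1)]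
  open scoped MatrixOrder Matrix.Norms.L2Operator in
  obtain ⟨B, hB⟩ := CStarAlgebra.nonneg_iff_eq_star_mul_self.1 hh.inv.posSemidef.nonneg
  rw [star_eq_conjTranspose, conjTranspose_eq_transpose_of_trivial] at hB
  have h1 : (h⁻¹ * A * h⁻¹ * Aᵀ).trace = ((B * A * Bᵀ) * (B * A * Bᵀ)ᵀ).trace := by
    rw [hB]
    simp only [transpose_mul, transpose_transpose, Matrix.mul_assoc]
    rw [Matrix.trace_mul_comm]
    simp only [Matrix.mul_assoc]
  rw [h1, ← Matrix.sum_sum_mul_eq_trace]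
  exact Finset.sum_nonneg fun _ _ => Finset.sum_nonneg fun _ _ => mul_self_nonneg _

/-- The shear is the trace-free part of `k`, hence orthogonal to γ, and |γ|² = n. -/
theorem tensorNormSq_shear (hn : n ≠ 0) (hγ : IsMetricCurve I γ) (ht : t ∈ I) :
    tensorNormSq (γ t) (shear I γ t)
      = ((γ t)⁻¹ * secondForm I γ t * (γ t)⁻¹ * secondForm I γ t).trace
        - n * hubble I γ t ^ 2 := by
  have hH : metricTrace (γ t) (secondForm I γ t) = -(n * hubble I γ t) := by
    have : (n : ℝ) ≠ 0 := by exact_mod_cast hn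
    rw [hubble]
    field_simp
  have h := hγ.isUnit_det ht
  rw [tensorNormSq_eq_trace _ _ (hγ.isSymm ht), shear, transpose_add, transpose_smul,
    hγ.isSymm_secondForm ht, hγ.isSymm ht]
  rw [metricTrace] at hH
  simp only [mul_add, add_mul, trace_add, Matrix.mul_smul, Matrix.smul_mul, trace_smul,
    Matrix.nonsing_inv_mul _ h, Matrix.one_mul, Matrix.mul_one, smul_eq_mul,
    hH, trace_one, Fintype.card_fin,
    Matrix.mul_assoc _ (γ t)⁻¹ (γ t)]
  ring

end IsMetricCurve
end Geometry

/-! ### Algebraic passage to the Einstein frame. -/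

section Algebra

variable {n ξ κ x y z H Hd s r ρ p V u : ℝ}

/-- The Hamiltonian constraint. -/
def HamiltonianEq (n ξ x y H s r ρ V : ℝ) : Prop :=
  (1 - ξ * x ^ 2) / 2 * (n * (n - 1) * H ^ 2 - s - r)
    = y ^ 2 / 2 + 2 * ξ * n * H * x * y + V + ρ

/-- The trace of the Einstein equations; `B` is the wave operator applied to the field and `R` the
scalar curvature of space-time. -/
def TraceEq (n ξ x y B R ρ p V : ℝ) : Prop :=
  -(n - 1) / 2 * (1 - ξ * x ^ 2) * R
    = -(1 - 2 * ξ) * y ^ 2 - (2 * ξ - 1 / 2) * (n + 1) * y ^ 2 + 2 * ξ * n * x * B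
      - (n + 1) * V - ρ + p

/-- The field equation. -/
def FieldEq (ξ κ x B R V : ℝ) : Prop := B - ξ * R * x + κ * V = 0

/-- The logarithmic derivative of the conformal factor. -/
def conformalRate (n ξ x y : ℝ) : ℝ := -2 * ξ * x * y / ((n - 1) * (1 - ξ * x ^ 2))

/-- The coefficient of the kinetic energy in the Einstein frame, multiplied by `(1 - ξ x²)²`. -/
def kinCoeff (n ξ x : ℝ) : ℝ := 1 - ξ * x ^ 2 + 4 * n * ξ ^ 2 * x ^ 2 / (n - 1)

/-- The logarithmic derivative of the potential in the Einstein frame, multiplied by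
`1 - ξ x²`. -/
def potSlope (n ξ κ x : ℝ) : ℝ := -κ * (1 - ξ * x ^ 2) + 2 * ((n + 1) / (n - 1)) * ξ * x

/-- The energy of matter, shear and spatial curvature in the Einstein frame. -/
def anisoEnergy (ξ x s r ρ : ℝ) : ℝ := ρ / (1 - ξ * x ^ 2) + s / 2 + r / 2

/-- Completing the square in `H`: after division by 1 - ξx², the indefinite cross term 2ξnHxy is
exactly what the shift by `conformalRate` absorbs, and the square of the shift supplies the second
summand of `kinCoeff`. -/
theorem hamiltonian_conformal (hn : 1 < n) (hu : 0 < 1 - ξ * x ^ 2)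
    (h : HamiltonianEq n ξ x y H s r ρ V) :
    n * (n - 1) / 2 * (H + conformalRate n ξ x y) ^ 2
      = kinCoeff n ξ x / (1 - ξ * x ^ 2) ^ 2 * y ^ 2 / 2 + V / (1 - ξ * x ^ 2)
        + anisoEnergy ξ x s r ρ := by
  have hn' : n - 1 ≠ 0 := by linarith
  unfold HamiltonianEq at h
  unfold conformalRate kinCoeff anisoEnergy
  generalize hw : 1 - ξ * x ^ 2 = w at *
  have hw0 : w ≠ 0 := hu.ne'
  field_simp
  field_simp at h
  linear_combination (n - 1) * w * h

/-- The left side is the time derivative of `H + conformalRate`. The combination of the trace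
equation and the constraint is chosen so that `V` cancels, leaving a dissipative bracket. -/
theorem raychaudhuri_conformal (hn : 1 < n) (hu : 0 < 1 - ξ * x ^ 2)
    (h : HamiltonianEq n ξ x y H s r ρ V)
    (h2 : TraceEq n ξ x y (-z - n * H * y) (2 * n * Hd + n * (n + 1) * H ^ 2 + s - r) ρ p V) :
    Hd - 2 * ξ * (y ^ 2 + x * z) / ((n - 1) * (1 - ξ * x ^ 2))
        - 4 * ξ ^ 2 * x ^ 2 * y ^ 2 / ((n - 1) * (1 - ξ * x ^ 2) ^ 2)
      = conformalRate n ξ x y * (H + conformalRate n ξ x y)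
        - (kinCoeff n ξ x / (1 - ξ * x ^ 2) ^ 2 * y ^ 2 + s + r / n
          + (ρ + p / n) / (1 - ξ * x ^ 2)) / (n - 1) := by
  have hn' : n - 1 ≠ 0 := by linarith
  have hn0 : n ≠ 0 := by linarith
  unfold HamiltonianEq at h
  unfold TraceEq at h2
  unfold conformalRate kinCoeff
  generalize hw : 1 - ξ * x ^ 2 = w at *
  have hw0 : w ≠ 0 := hu.ne'
  linear_combination (norm := skip) (-(n + 1) / ((n - 1) * n * w)) * h
    - (1 / ((n - 1) * n * w)) * h2
  field_simp
  ring

/-- Eliminates the space-time curvature `R` between the trace and field equations, so that the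
second derivative of the field can be solved for. -/
theorem wave_conformal (hn : 1 < n) {R : ℝ}
    (h2 : TraceEq n ξ x y (-z - n * H * y) R ρ p V)
    (h3 : FieldEq ξ κ x (-z - n * H * y) R V) :
    kinCoeff n ξ x * z = -n * H * kinCoeff n ξ x * y - V * potSlope n ξ κ x
      + 2 * ξ * x / (n - 1) * (((n - 1) / 2 - 2 * n * ξ) * y ^ 2 + p - ρ) := by
  have hn' : n - 1 ≠ 0 := by linarith
  unfold TraceEq at h2
  unfold FieldEq at h3
  unfold kinCoeff potSlope
  field_simp
  field_simp at h2
  linear_combination ξ * x * h2 - (1 - ξ * x ^ 2) * (n - 1) * h3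

/-- `d/dt` of the energy in the Einstein frame, computed from the Hamiltonian constraint. -/
theorem anisoEnergy_deriv {P Pd om : ℝ} (hn : 1 < n) (hu : 0 < 1 - ξ * x ^ 2)
    (hom : om = conformalRate n ξ x y)
    (hP : P = H + om)
    (h1 : n * (n - 1) / 2 * P ^ 2
      = kinCoeff n ξ x / (1 - ξ * x ^ 2) ^ 2 * y ^ 2 / 2 + V / (1 - ξ * x ^ 2)
        + anisoEnergy ξ x s r ρ)
    (h2 : Pd = om * P - (kinCoeff n ξ x / (1 - ξ * x ^ 2) ^ 2 * y ^ 2 + s + r / n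
          + (ρ + p / n) / (1 - ξ * x ^ 2)) / (n - 1))
    (h3 : kinCoeff n ξ x * z = -n * H * kinCoeff n ξ x * y - V * potSlope n ξ κ x
      + 2 * ξ * x / (n - 1) * (((n - 1) / 2 - 2 * n * ξ) * y ^ 2 + p - ρ)) :
    n * (n - 1) * P * Pd - kinCoeff n ξ x / (1 - ξ * x ^ 2) ^ 2 * y * z
      - (-2 * ξ * x + 8 * n * ξ ^ 2 * x / (n - 1)) * y / (1 - ξ * x ^ 2) ^ 2 * y ^ 2 / 2
      - 2 * ξ * x * y * kinCoeff n ξ x / (1 - ξ * x ^ 2) ^ 3 * y ^ 2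
      + κ * V * y / (1 - ξ * x ^ 2) - 2 * ξ * x * y * V / (1 - ξ * x ^ 2) ^ 2
      = 2 * om * anisoEnergy ξ x s r ρ - P * (n * s + r + (n * ρ + p) / (1 - ξ * x ^ 2))
        + om * (p - ρ) / (1 - ξ * x ^ 2) := by
  have hn' : n - 1 ≠ 0 := by linarith
  have hn0 : n ≠ 0 := by linarith
  have hH : H = P - om := by linarith
  have hw0 : 1 - ξ * x ^ 2 ≠ 0 := hu.ne'
  subst h2 hH
  -- The derivative of P contributes n(n-1)·om·P², which the constraint `h1` turns into energies;
  -- `h3` removes `z`.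
  linear_combination (norm := skip) 2 * om * h1 - y / (1 - ξ * x ^ 2) ^ 2 * h3
  rw [hom]
  unfold conformalRate kinCoeff potSlope
  generalize anisoEnergy ξ x s r ρ = W
  field_simp
  ring

end Algebra

/-! ### Monotone limits, Gronwall, continuation and Barbalat. -/

section Analysis

theorem tendsto_of_antitoneOn_Ici {f : ℝ → ℝ} {a m : ℝ} (hf : AntitoneOn f (Ici a))
    (hm : ∀ t ∈ Ici a, m ≤ f t) : ∃ l, Tendsto f atTop (𝓝 l) := by
  have h1 : Antitone fun t => f (max a t) := fun s t hst =>
    hf (mem_Ici.2 (le_max_left _ _)) (mem_Ici.2 (le_max_left _ _)) (max_le_max_left _ hst)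
  have h2 : BddBelow (range fun t => f (max a t)) := by
    refine ⟨m, ?_⟩
    rintro _ ⟨t, rfl⟩
    exact hm _ (mem_Ici.2 (le_max_left _ _))
  refine ⟨_, (tendsto_atTop_ciInf h1 h2).congr' ?_⟩
  filter_upwards [eventually_ge_atTop a] with t ht
  rw [max_eq_right ht]

theorem antitoneOn_Ici_of_hasDerivWithinAt {f f' : ℝ → ℝ} {a : ℝ}
    (hf : ∀ t ∈ Ici a, HasDerivWithinAt f (f' t) (Ici a) t) (hf' : ∀ t ∈ Ici a, f' t ≤ 0) :
    AntitoneOn f (Ici a) := by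
  refine antitoneOn_of_hasDerivWithinAt_nonpos (convex_Ici a)
    (fun t ht => (hf t ht).continuousWithinAt) (f' := f') (fun t ht => ?_) fun t ht => ?_
  · exact (hf t (interior_subset ht)).mono interior_subset
  · exact hf' t (interior_subset ht)

/-- Differential Gronwall inequality with a variable rate. -/
theorem le_mul_exp_of_deriv_le {f f' A A' : ℝ → ℝ} {a : ℝ}
    (hf : ∀ t ∈ Ici a, HasDerivWithinAt f (f' t) (Ici a) t)
    (hA : ∀ t ∈ Ici a, HasDerivWithinAt A (A' t) (Ici a) t)
    (h : ∀ t ∈ Ici a, f' t ≤ A' t * f t) :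
    ∀ t ∈ Ici a, f t ≤ f a * Real.exp (-A a) * Real.exp (A t) := by
  have hanti : AntitoneOn (fun t => f t * Real.exp (-A t)) (Ici a) := by
    refine antitoneOn_Ici_of_hasDerivWithinAt (fun t ht => (hf t ht).mul (hA t ht).neg.exp) ?_
    intro t ht
    have := mul_le_mul_of_nonneg_right (h t ht) (Real.exp_pos (-A t)).le
    simp only [Pi.neg_apply]
    nlinarith
  intro t ht
  have h1 := hanti self_mem_Ici ht ht
  calc f t = f t * Real.exp (-A t) * Real.exp (A t) := by
        rw [mul_assoc, ← Real.exp_add]; simp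
    _ ≤ _ := mul_le_mul_of_nonneg_right h1 (Real.exp_pos _).le

/-- A function that dominates a fixed positive constant as long as it stays positive is positive
throughout. -/
theorem pos_of_forall_pos_imp_ge {f : ℝ → ℝ} {a c : ℝ} (hc : 0 < c)
    (hf : ContinuousOn f (Ici a)) (ha : 0 < f a)
    (h : ∀ t ∈ Ici a, (∀ s ∈ Icc a t, 0 < f s) → c ≤ f t) : ∀ t ∈ Ici a, 0 < f t := by
  by_contra! hneg
  obtain ⟨b, hb, hfb⟩ := hneg
  have hac : c ≤ f a := h a self_mem_Ici fun s hs => by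
    rw [Icc_self, mem_singleton_iff] at hs
    rwa [hs]
  -- At the first time in `Z` the function is still positive on the whole past, yet equals c/2 < c,
  -- contradicting `h`.
  let Z := Icc a b ∩ f ⁻¹' {c / 2}
  have hcont : ContinuousOn f (Icc a b) := hf.mono Icc_subset_Ici_self
  have hZc : IsCompact Z := isCompact_Icc.of_isClosed_subset
    (hcont.preimage_isClosed_of_isClosed isClosed_Icc isClosed_singleton) inter_subset_left
  have hZn : Z.Nonempty := by
    obtain ⟨s, hs, hfs⟩ := intermediate_value_Icc' hb hcont
      (show c / 2 ∈ Icc (f b) (f a) from ⟨by linarith, by linarith⟩)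
    exact ⟨s, hs, hfs⟩
  obtain ⟨s, hs, hmin⟩ := hZc.exists_isLeast hZn
  have hfs : f s = c / 2 := hs.2
  have hpos : ∀ r ∈ Icc a s, 0 < f r := by
    intro r hr
    by_contra! hr0
    obtain ⟨q, hq, hfq⟩ := intermediate_value_Icc' hr.1
      (hf.mono Icc_subset_Ici_self) (show c / 2 ∈ Icc (f r) (f a) from ⟨by linarith, by linarith⟩)
    have h1 : s ≤ q := hmin ⟨⟨hq.1, hq.2.trans (hr.2.trans hs.1.2)⟩, hfq⟩
    have h2 : r = s := le_antisymm hr.2 (h1.trans hq.2)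
    rw [h2, hfs] at hr0
    linarith
  have := h s hs.1.1 hpos
  linarith

/-- A form of Barbalat's lemma. -/
theorem eventually_lt_of_tendsto_of_deriv_le {f f' G e : ℝ → ℝ} {T M l : ℝ}
    (hf : ∀ t ∈ Ici T, HasDerivWithinAt f (f' t) (Ici T) t)
    (hlim : Tendsto f atTop (𝓝 l)) (he : Tendsto e atTop (𝓝 0))
    (hle : ∀ t ∈ Ici T, f' t ≤ -G t + e t)
    (hG : ∀ t ∈ Ici T, ∀ s ∈ Ici t, |G s - G t| ≤ M * (s - t)) {ε : ℝ} (hε : 0 < ε) :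
    ∀ᶠ t in atTop, G t < ε := by
  -- On a window of length `d`, `G` varies by at most ε/4. If `G t ≥ ε`, then f' ≤ -3ε/4 + ε/4 =
  -- -ε/2 there once `e` is below ε/4, so `f` drops by at least dε/2, which convergence of `f`
  -- eventually excludes.
  set d := ε / (4 * (|M| + 1)) with hd
  have hM : 0 < |M| + 1 := by positivity
  have hd0 : 0 < d := by positivity
  have hMd : ∀ x, 0 ≤ x → x ≤ d → M * x ≤ ε / 4 := by
    intro x hx hxd
    calc M * x ≤ (|M| + 1) * d := by
          have := le_abs_self M
          nlinarith
      _ = ε / 4 := by rw [hd]; field_simp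
  have h1 : ∀ᶠ t in atTop, |f (t + d) - f t| < d * ε / 2 := by
    have h2 : Tendsto (fun t => f (t + d) - f t) atTop (𝓝 (l - l)) :=
      (hlim.comp (tendsto_atTop_add_const_right _ d tendsto_id)).sub hlim
    rw [sub_self] at h2
    have := h2.abs
    rw [abs_zero] at this
    exact this.eventually_lt_const (by positivity)
  have h3 : ∀ᶠ t in atTop, ∀ s ≥ t, e s < ε / 4 :=
    eventually_forall_ge_atTop.2 (he.eventually_lt_const (by positivity))
  filter_upwards [h1, h3, eventually_ge_atTop T] with t ht1 ht3 htT
  by_contra! hGt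
  have hanti : AntitoneOn (fun s => f s + ε / 2 * s) (Icc t (t + d)) := by
    refine antitoneOn_of_hasDerivWithinAt_nonpos (convex_Icc _ _) (f' := fun s => f' s + ε / 2)
      (fun s hs => ?_) (fun s hs => ?_) fun s hs => ?_
    · exact (((hf s (htT.trans hs.1)).mono fun q hq => htT.trans hq.1).add
        ((hasDerivWithinAt_id s _).const_mul (ε / 2))).continuousWithinAt
    · have hs' := interior_subset hs
      have hsub : interior (Icc t (t + d)) ⊆ Ici T := fun q hq =>
        htT.trans (interior_subset hq : q ∈ Icc t (t + d)).1
      exact (((hf s (htT.trans hs'.1)).mono hsub).fun_add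
        ((hasDerivWithinAt_id s _).const_mul (ε / 2))).congr_deriv (by ring)
    · have hs' := interior_subset hs
      have h4 := hle s (htT.trans hs'.1)
      have h5 := ht3 s hs'.1
      have h6 := (abs_le.1 (hG t htT s hs'.1)).1
      have h7 := hMd (s - t) (by linarith [hs'.1]) (by linarith [hs'.2])
      linarith
  have h8 := hanti (left_mem_Icc.2 (by linarith)) (right_mem_Icc.2 (by linarith))
    (by linarith : t ≤ t + d)
  have h9 := (abs_lt.1 ht1).1
  simp only at h8
  linarith

theorem abs_sub_le_of_hasDerivWithinAt {f f' : ℝ → ℝ} {T C : ℝ}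
    (hf : ∀ t ∈ Ici T, HasDerivWithinAt f (f' t) (Ici T) t) (hC : ∀ t ∈ Ici T, |f' t| ≤ C) :
    ∀ t ∈ Ici T, ∀ s ∈ Ici t, |f s - f t| ≤ C * (s - t) := by
  intro t ht s hs
  have := (convex_Ici T).norm_image_sub_le_of_norm_hasDerivWithin_le hf hC ht
    (mem_Ici.2 (le_trans ht hs))
  rwa [Real.norm_eq_abs, Real.norm_eq_abs, abs_of_nonneg (sub_nonneg.2 (mem_Ici.1 hs))] at this

end Analysis

/-! ### The scalar system and positivity of `1 - ξ * x ^ 2`. -/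

/-- The dissipation rate of the Hubble parameter of the Einstein frame. -/
def dissipation (n ξ x y s r ρ p : ℝ) : ℝ :=
  kinCoeff n ξ x / (1 - ξ * x ^ 2) ^ 2 * y ^ 2 + s + r / n + (ρ + p / n) / (1 - ξ * x ^ 2)

theorem le_kinCoeff {n ξ : ℝ} (hn : 1 < n) (x : ℝ) : 1 - ξ * x ^ 2 ≤ kinCoeff n ξ x := by
  have : 0 ≤ 4 * n * ξ ^ 2 * x ^ 2 / (n - 1) := by
    apply div_nonneg _ (by linarith)
    positivity
  unfold kinCoeff
  linarith

/-- The scalar equations satisfied by a spatially homogeneous solution: `x, y, z` are the scalar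
field and its first two derivatives, `H, Hd` the Hubble parameter and its derivative, `s` the square
of the shear, `r` minus the spatial scalar curvature, `ρ` the density and `p` the trace of the
pressure. -/
structure CoupledSystem (n ξ lam κ a : ℝ) (x y z H Hd s r ρ p : ℝ → ℝ) : Prop where
  three_le : 3 ≤ n
  ξ_pos : 0 < ξ
  lam_pos : 0 < lam
  κ_pos : 0 < κ
  deriv_x : ∀ t ∈ Ici a, HasDerivWithinAt x (y t) (Ici a) t
  deriv_y : ∀ t ∈ Ici a, HasDerivWithinAt y (z t) (Ici a) t
  deriv_H : ∀ t ∈ Ici a, HasDerivWithinAt H (Hd t) (Ici a) t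
  s_nonneg : ∀ t ∈ Ici a, 0 ≤ s t
  r_nonneg : ∀ t ∈ Ici a, 0 ≤ r t
  ρ_nonneg : ∀ t ∈ Ici a, 0 ≤ ρ t
  abs_p_le : ∀ t ∈ Ici a, |p t| ≤ n * ρ t
  strong : ∀ t ∈ Ici a, 0 ≤ ρ t + p t
  hamiltonian : ∀ t ∈ Ici a,
    HamiltonianEq n ξ (x t) (y t) (H t) (s t) (r t) (ρ t) (expPotential lam κ (x t))
  trace : ∀ t ∈ Ici a, TraceEq n ξ (x t) (y t) (-z t - n * H t * y t)
    (2 * n * Hd t + n * (n + 1) * H t ^ 2 + s t - r t) (ρ t) (p t) (expPotential lam κ (x t))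
  field : ∀ t ∈ Ici a, FieldEq ξ κ (x t) (-z t - n * H t * y t)
    (2 * n * Hd t + n * (n + 1) * H t ^ 2 + s t - r t) (expPotential lam κ (x t))
  u_init : 0 < 1 - ξ * x a ^ 2
  expanding : 0 < H a + conformalRate n ξ (x a) (y a)

namespace CoupledSystem

variable {n ξ lam κ a : ℝ} {x y z H Hd s r ρ p : ℝ → ℝ} {t : ℝ}

theorem one_lt (h : CoupledSystem n ξ lam κ a x y z H Hd s r ρ p) : 1 < n := by
  linarith [h.three_le]

theorem hasDeriv_u (h : CoupledSystem n ξ lam κ a x y z H Hd s r ρ p) (ht : t ∈ Ici a) :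
    HasDerivWithinAt (fun t => 1 - ξ * x t ^ 2) (-2 * ξ * x t * y t) (Ici a) t := by
  refine ((((h.deriv_x t ht).pow 2).const_mul ξ).const_sub 1).congr_deriv ?_
  simp
  ring

theorem hasDeriv_rate (h : CoupledSystem n ξ lam κ a x y z H Hd s r ρ p) (ht : t ∈ Ici a)
    (hu : 0 < 1 - ξ * x t ^ 2) :
    HasDerivWithinAt (fun t => conformalRate n ξ (x t) (y t))
      (-2 * ξ * (y t ^ 2 + x t * z t) / ((n - 1) * (1 - ξ * x t ^ 2))
        - 4 * ξ ^ 2 * x t ^ 2 * y t ^ 2 / ((n - 1) * (1 - ξ * x t ^ 2) ^ 2)) (Ici a) t := by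
  have hn : n - 1 ≠ 0 := by linarith [h.one_lt]
  have := ((((h.deriv_x t ht).const_mul (-2 * ξ)).mul (h.deriv_y t ht)).div
    ((h.hasDeriv_u ht).const_mul (n - 1)) (mul_ne_zero hn hu.ne'))
  refine this.congr_deriv ?_
  have := hu.ne'
  simp only [Pi.mul_apply]
  field_simp
  ring

theorem hasDeriv_P (h : CoupledSystem n ξ lam κ a x y z H Hd s r ρ p) (ht : t ∈ Ici a)
    (hu : 0 < 1 - ξ * x t ^ 2) :
    HasDerivWithinAt (fun t => H t + conformalRate n ξ (x t) (y t))
      (conformalRate n ξ (x t) (y t) * (H t + conformalRate n ξ (x t) (y t))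
        - dissipation n ξ (x t) (y t) (s t) (r t) (ρ t) (p t) / (n - 1)) (Ici a) t := by
  refine ((h.deriv_H t ht).fun_add (h.hasDeriv_rate ht hu)).congr_deriv ?_
  rw [dissipation, ← raychaudhuri_conformal h.one_lt hu (h.hamiltonian t ht) (h.trace t ht)]
  ring

/-- The logarithm of the Hubble parameter in the Einstein frame is a Lyapunov function. -/
theorem hasDeriv_log (h : CoupledSystem n ξ lam κ a x y z H Hd s r ρ p) (ht : t ∈ Ici a)
    (hu : 0 < 1 - ξ * x t ^ 2) (hP : 0 < H t + conformalRate n ξ (x t) (y t)) :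
    HasDerivWithinAt (fun t => Real.log (H t + conformalRate n ξ (x t) (y t))
        - Real.log (1 - ξ * x t ^ 2) / (n - 1))
      (-(dissipation n ξ (x t) (y t) (s t) (r t) (ρ t) (p t)
        / ((n - 1) * (H t + conformalRate n ξ (x t) (y t))))) (Ici a) t := by
  refine (((h.hasDeriv_P ht hu).log hP.ne').fun_sub
    (((h.hasDeriv_u ht).log hu.ne').div_const (n - 1))).congr_deriv ?_
  have hn : n - 1 ≠ 0 := by linarith [h.one_lt]
  generalize dissipation n ξ (x t) (y t) (s t) (r t) (ρ t) (p t) = N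
  have hom : -2 * ξ * x t * y t / (1 - ξ * x t ^ 2) / (n - 1) = conformalRate n ξ (x t) (y t) := by
    rw [conformalRate, div_div, mul_comm (n - 1)]
  rw [hom]
  generalize H t + conformalRate n ξ (x t) (y t) = P at *
  have := hP.ne'
  field_simp
  ring

/-- With u = 1 - ξx² in (0, 1], one has `kinCoeff` ≥ u ≥ u². -/
theorem one_le_kinetic_coeff (h : CoupledSystem n ξ lam κ a x y z H Hd s r ρ p)
    (hu : 0 < 1 - ξ * x t ^ 2) : 1 ≤ kinCoeff n ξ (x t) / (1 - ξ * x t ^ 2) ^ 2 := by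
  rw [one_le_div (by positivity)]
  have := le_kinCoeff (ξ := ξ) h.one_lt (x t)
  have h2 : 0 ≤ ξ * x t ^ 2 := mul_nonneg h.ξ_pos.le (sq_nonneg _)
  nlinarith

/-- The dominant energy condition makes ρ + p/n non-negative, so only the kinetic term needs to be
kept. This is the source of all control on the velocity of the field. -/
theorem sq_le_dissipation (h : CoupledSystem n ξ lam κ a x y z H Hd s r ρ p) (ht : t ∈ Ici a)
    (hu : 0 < 1 - ξ * x t ^ 2) :
    y t ^ 2 ≤ dissipation n ξ (x t) (y t) (s t) (r t) (ρ t) (p t) := by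
  have hn : 0 < n := by linarith [h.one_lt]
  have h1 := h.one_le_kinetic_coeff hu
  have h2 : 0 ≤ (ρ t + p t / n) / (1 - ξ * x t ^ 2) := by
    apply div_nonneg _ hu.le
    have h3 := (abs_le.1 (h.abs_p_le t ht)).1
    have : -ρ t ≤ p t / n := by
      rw [le_div_iff₀ hn]
      linarith
    linarith
  have h3 : 0 ≤ r t / n := div_nonneg (h.r_nonneg t ht) hn.le
  have h4 := h.s_nonneg t ht
  have h5 := mul_le_mul_of_nonneg_right h1 (sq_nonneg (y t))
  unfold dissipation
  linarith

theorem anisoEnergy_nonneg (h : CoupledSystem n ξ lam κ a x y z H Hd s r ρ p) (ht : t ∈ Ici a)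
    (hu : 0 < 1 - ξ * x t ^ 2) : 0 ≤ anisoEnergy ξ (x t) (s t) (r t) (ρ t) := by
  have h1 := div_nonneg (h.ρ_nonneg t ht) hu.le
  have h2 := h.s_nonneg t ht
  have h3 := h.r_nonneg t ht
  unfold anisoEnergy
  linarith

theorem constraint (h : CoupledSystem n ξ lam κ a x y z H Hd s r ρ p) (ht : t ∈ Ici a)
    (hu : 0 < 1 - ξ * x t ^ 2) :
    n * (n - 1) / 2 * (H t + conformalRate n ξ (x t) (y t)) ^ 2
      = kinCoeff n ξ (x t) / (1 - ξ * x t ^ 2) ^ 2 * y t ^ 2 / 2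
        + expPotential lam κ (x t) / (1 - ξ * x t ^ 2)
        + anisoEnergy ξ (x t) (s t) (r t) (ρ t) :=
  hamiltonian_conformal h.one_lt hu (h.hamiltonian t ht)

theorem kinetic_nonneg (h : CoupledSystem n ξ lam κ a x y z H Hd s r ρ p)
    (hu : 0 < 1 - ξ * x t ^ 2) :
    0 ≤ kinCoeff n ξ (x t) / (1 - ξ * x t ^ 2) ^ 2 * y t ^ 2 / 2 := by
  have := hu.le.trans (le_kinCoeff h.one_lt (x t))
  positivity

theorem potential_le (h : CoupledSystem n ξ lam κ a x y z H Hd s r ρ p) (ht : t ∈ Ici a)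
    (hu : 0 < 1 - ξ * x t ^ 2) :
    expPotential lam κ (x t) / (1 - ξ * x t ^ 2)
      ≤ n * (n - 1) / 2 * (H t + conformalRate n ξ (x t) (y t)) ^ 2 := by
  rw [h.constraint ht hu]
  have := h.kinetic_nonneg hu (t := t)
  have := h.anisoEnergy_nonneg ht hu
  linarith

theorem abs_x_le (h : CoupledSystem n ξ lam κ a x y z H Hd s r ρ p)
    (hu : 0 < 1 - ξ * x t ^ 2) : |x t| ≤ Real.sqrt (1 / ξ) := by
  apply Real.abs_le_sqrt
  have := h.ξ_pos
  rw [le_div_iff₀ this]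
  linarith

/-- A lower bound for the potential. -/
theorem potential_ge (h : CoupledSystem n ξ lam κ a x y z H Hd s r ρ p)
    (hu : 0 < 1 - ξ * x t ^ 2) :
    lam * Real.exp (-κ * Real.sqrt (1 / ξ)) ≤ expPotential lam κ (x t) := by
  have h1 := (abs_le.1 (h.abs_x_le hu)).2
  have := h.lam_pos
  have := h.κ_pos
  refine mul_le_mul_of_nonneg_left (Real.exp_le_exp.2 ?_) h.lam_pos.le
  nlinarith

theorem u_le_one (h : CoupledSystem n ξ lam κ a x y z H Hd s r ρ p) :
    1 - ξ * x t ^ 2 ≤ 1 := by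
  have : 0 ≤ ξ * x t ^ 2 := mul_nonneg h.ξ_pos.le (sq_nonneg _)
  linarith

/-- At a zero of `H + conformalRate` the constraint would force the positive potential term to be at
most 0, so the sign cannot change. -/
theorem P_pos_of_u_pos (h : CoupledSystem n ξ lam κ a x y z H Hd s r ρ p) (ht : t ∈ Ici a)
    (hu : ∀ q ∈ Icc a t, 0 < 1 - ξ * x q ^ 2) :
    0 < H t + conformalRate n ξ (x t) (y t) := by
  by_contra! hneg
  have hcont : ContinuousOn (fun t => H t + conformalRate n ξ (x t) (y t)) (Icc a t) :=
    fun q hq => ((h.hasDeriv_P hq.1 (hu q hq)).continuousWithinAt).mono Icc_subset_Ici_self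
  obtain ⟨q, hq, hq0⟩ := intermediate_value_Icc' ht hcont ⟨hneg, h.expanding.le⟩
  have h1 := h.potential_le hq.1 (hu q hq)
  simp only at hq0
  rw [hq0] at h1
  have h2 : 0 < expPotential lam κ (x q) := mul_pos h.lam_pos (Real.exp_pos _)
  have := div_pos h2 (hu q hq)
  norm_num at h1
  linarith

/-- The bound must not depend on `t`, so that `pos_of_forall_pos_imp_ge` can upgrade it to
positivity for all time. -/
theorem exists_u_ge (h : CoupledSystem n ξ lam κ a x y z H Hd s r ρ p) :
    ∃ c > 0, ∀ t ∈ Ici a, (∀ q ∈ Icc a t, 0 < 1 - ξ * x q ^ 2) → c ≤ 1 - ξ * x t ^ 2 := by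
  set L : ℝ → ℝ := fun t => Real.log (H t + conformalRate n ξ (x t) (y t))
        - Real.log (1 - ξ * x t ^ 2) / (n - 1) with hL
  have hn := h.one_lt
  have hn1 : 0 < n - 1 := by linarith
  have hm : 0 < lam * Real.exp (-κ * Real.sqrt (1 / ξ)) := mul_pos h.lam_pos (Real.exp_pos _)
  set v := Real.log (lam * Real.exp (-κ * Real.sqrt (1 / ξ))) - Real.log (n * (n - 1) / 2)
  have hk : 0 < 1 + 2 / (n - 1) := by positivity
  -- Taking logarithms in min V / u ≤ n(n-1)/2 · P² and inserting log P ≤ L(a) + (log u)/(n-1) gives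
  -- v - 2L(a) ≤ (1 + 2/(n-1)) log u.
  refine ⟨Real.exp ((v - 2 * L a) / (1 + 2 / (n - 1))), Real.exp_pos _, fun t ht hu => ?_⟩
  have hut := hu t (right_mem_Icc.2 ht)
  have hPt := h.P_pos_of_u_pos ht hu
  have hPq : ∀ q ∈ Icc a t, 0 < H q + conformalRate n ξ (x q) (y q) := fun q hq =>
    h.P_pos_of_u_pos hq.1 fun q' hq' => hu q' ⟨hq'.1, hq'.2.trans hq.2⟩
  have hderiv := fun q (hq : q ∈ Icc a t) => h.hasDeriv_log hq.1 (hu q hq) (hPq q hq)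
  have hanti : AntitoneOn L (Icc a t) := by
    refine antitoneOn_of_hasDerivWithinAt_nonpos (convex_Icc a t)
      (fun q hq => ((hderiv q hq).continuousWithinAt).mono Icc_subset_Ici_self)
      (fun q hq => (hderiv q (interior_subset hq)).mono
        (interior_subset.trans Icc_subset_Ici_self)) fun q hq => ?_
    have hq' := interior_subset hq
    have h1 := (sq_nonneg (y q)).trans (h.sq_le_dissipation hq'.1 (hu q hq'))
    have := hPq q hq'
    exact neg_nonpos.2 (by positivity)
  have h1 := hanti (left_mem_Icc.2 ht) (right_mem_Icc.2 ht) ht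
  have h2 : lam * Real.exp (-κ * Real.sqrt (1 / ξ)) / (1 - ξ * x t ^ 2)
      ≤ n * (n - 1) / 2 * (H t + conformalRate n ξ (x t) (y t)) ^ 2 :=
    le_trans (by have := h.potential_ge hut; gcongr) (h.potential_le ht hut)
  have h3 := Real.log_le_log (by positivity) h2
  have hn2 : n * (n - 1) / 2 ≠ 0 := by positivity
  rw [Real.log_div hm.ne' hut.ne', Real.log_mul hn2 (by positivity), Real.log_pow] at h3
  rw [← Real.le_log_iff_exp_le hut, div_le_iff₀ hk]
  have h4 : L t = Real.log (H t + conformalRate n ξ (x t) (y t))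
        - Real.log (1 - ξ * x t ^ 2) / (n - 1) := rfl
  have h5 : Real.log (1 - ξ * x t ^ 2) * (1 + 2 / (n - 1))
    = Real.log (1 - ξ * x t ^ 2) + 2 * (Real.log (1 - ξ * x t ^ 2) / (n - 1)) := by ring
  rw [h5]
  push_cast at h3
  linarith

theorem u_pos (h : CoupledSystem n ξ lam κ a x y z H Hd s r ρ p) :
    ∀ t ∈ Ici a, 0 < 1 - ξ * x t ^ 2 := by
  obtain ⟨c, hc, hcu⟩ := h.exists_u_ge
  exact pos_of_forall_pos_imp_ge hc (fun t ht => (h.hasDeriv_u ht).continuousWithinAt) h.u_init hcu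

theorem P_pos (h : CoupledSystem n ξ lam κ a x y z H Hd s r ρ p) (ht : t ∈ Ici a) :
    0 < H t + conformalRate n ξ (x t) (y t) :=
  h.P_pos_of_u_pos ht fun q hq => h.u_pos q hq.1

end CoupledSystem

/-! ### A priori bounds and decay of the energy. -/

namespace CoupledSystem

variable {n ξ lam κ a : ℝ} {x y z H Hd s r ρ p : ℝ → ℝ} {t : ℝ}

theorem hasDeriv_kinCoeff (h : CoupledSystem n ξ lam κ a x y z H Hd s r ρ p) (ht : t ∈ Ici a) :
    HasDerivWithinAt (fun t => kinCoeff n ξ (x t))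
      ((-2 * ξ * x t + 8 * n * ξ ^ 2 * x t / (n - 1)) * y t) (Ici a) t := by
  refine ((h.hasDeriv_u ht).fun_add ((((h.deriv_x t ht).pow 2).const_mul
    (4 * n * ξ ^ 2)).div_const (n - 1))).congr_deriv ?_
  simp
  ring

theorem hasDeriv_potential (h : CoupledSystem n ξ lam κ a x y z H Hd s r ρ p) (ht : t ∈ Ici a) :
    HasDerivWithinAt (fun t => expPotential lam κ (x t))
      (-κ * expPotential lam κ (x t) * y t) (Ici a) t := by
  refine ((((h.deriv_x t ht).const_mul (-κ)).exp).const_mul lam).congr_deriv ?_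
  unfold expPotential
  ring

theorem wave (h : CoupledSystem n ξ lam κ a x y z H Hd s r ρ p) (ht : t ∈ Ici a) :
    kinCoeff n ξ (x t) * z t = -n * H t * kinCoeff n ξ (x t) * y t
      - expPotential lam κ (x t) * potSlope n ξ κ (x t)
      + 2 * ξ * x t / (n - 1) * (((n - 1) / 2 - 2 * n * ξ) * y t ^ 2 + p t - ρ t) :=
  wave_conformal h.one_lt (h.trace t ht) (h.field t ht)

/-- By the constraint the energy equals n(n-1)/2 · P² minus the kinetic and potential terms, all of
whose derivatives are known. Only the sum is differentiated, never shear, curvature or density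
separately. -/
theorem hasDeriv_anisoEnergy (h : CoupledSystem n ξ lam κ a x y z H Hd s r ρ p) (ht : t ∈ Ici a) :
    HasDerivWithinAt (fun t => anisoEnergy ξ (x t) (s t) (r t) (ρ t))
      (2 * conformalRate n ξ (x t) (y t) * anisoEnergy ξ (x t) (s t) (r t) (ρ t)
        - (H t + conformalRate n ξ (x t) (y t))
          * (n * s t + r t + (n * ρ t + p t) / (1 - ξ * x t ^ 2))
        + conformalRate n ξ (x t) (y t) * (p t - ρ t) / (1 - ξ * x t ^ 2)) (Ici a) t := by
  have hu := h.u_pos t ht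
  have hd := ((((h.hasDeriv_P ht hu).pow 2).const_mul (n * (n - 1) / 2)).fun_sub
    ((((h.hasDeriv_kinCoeff ht).fun_div ((h.hasDeriv_u ht).fun_pow 2) (pow_ne_zero 2 hu.ne')).fun_mul
      ((h.deriv_y t ht).fun_pow 2)).div_const 2)).fun_sub
    ((h.hasDeriv_potential ht).fun_div (h.hasDeriv_u ht) hu.ne')
  have he := (hd.congr (f₁ := fun t => anisoEnergy ξ (x t) (s t) (r t) (ρ t))
    (fun q hq => by
      have := h.constraint hq (h.u_pos q hq)
      simp only [Pi.pow_apply]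
      linarith)
    (by
      have := h.constraint ht hu
      simp only [Pi.pow_apply]
      linarith))
  refine he.congr_deriv ?_
  rw [← anisoEnergy_deriv h.one_lt hu rfl rfl (h.constraint ht hu) rfl (h.wave ht)]
  have hn : n - 1 ≠ 0 := by linarith [h.one_lt]
  have hu' := hu.ne'
  rw [dissipation]
  generalize H t + conformalRate n ξ (x t) (y t) = P
  generalize conformalRate n ξ (x t) (y t) = om
  generalize hw : 1 - ξ * x t ^ 2 = w at *
  generalize kinCoeff n ξ (x t) = K
  field_simp
  push_cast
  ring

/-- The Lyapunov function. -/
def lyap (n ξ : ℝ) (x y H : ℝ → ℝ) (t : ℝ) : ℝ :=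
  Real.log (H t + conformalRate n ξ (x t) (y t)) - Real.log (1 - ξ * x t ^ 2) / (n - 1)

/-- The derivative of the Lyapunov function. -/
def lyapDeriv (n ξ : ℝ) (x y H s r ρ p : ℝ → ℝ) (t : ℝ) : ℝ :=
  -(dissipation n ξ (x t) (y t) (s t) (r t) (ρ t) (p t)
        / ((n - 1) * (H t + conformalRate n ξ (x t) (y t))))

theorem hasDeriv_lyap (h : CoupledSystem n ξ lam κ a x y z H Hd s r ρ p) (ht : t ∈ Ici a) :
    HasDerivWithinAt (lyap n ξ x y H) (lyapDeriv n ξ x y H s r ρ p t) (Ici a) t :=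
  h.hasDeriv_log ht (h.u_pos t ht) (h.P_pos ht)

theorem antitoneOn_lyap (h : CoupledSystem n ξ lam κ a x y z H Hd s r ρ p) :
    AntitoneOn (lyap n ξ x y H) (Ici a) := by
  refine antitoneOn_Ici_of_hasDerivWithinAt (fun t ht => h.hasDeriv_lyap ht) fun t ht => ?_
  have h1 := (sq_nonneg (y t)).trans (h.sq_le_dissipation ht (h.u_pos t ht))
  have := h.P_pos ht
  have : 0 < n - 1 := by linarith [h.one_lt]
  exact neg_nonpos.2 (by positivity)

theorem exists_u_lower (h : CoupledSystem n ξ lam κ a x y z H Hd s r ρ p) :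
    ∃ c > 0, ∀ t ∈ Ici a, c ≤ 1 - ξ * x t ^ 2 := by
  obtain ⟨c, hc, hcu⟩ := h.exists_u_ge
  exact ⟨c, hc, fun t ht => hcu t ht fun q hq => h.u_pos q hq.1⟩

theorem exists_P_lower (h : CoupledSystem n ξ lam κ a x y z H Hd s r ρ p) :
    ∃ c > 0, ∀ t ∈ Ici a, c ≤ H t + conformalRate n ξ (x t) (y t) := by
  have hm : 0 < lam * Real.exp (-κ * Real.sqrt (1 / ξ)) := mul_pos h.lam_pos (Real.exp_pos _)
  have hn : 0 < n * (n - 1) / 2 := by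
    have := h.one_lt
    have : 0 < n - 1 := by linarith
    positivity
  refine ⟨Real.sqrt (lam * Real.exp (-κ * Real.sqrt (1 / ξ)) / (n * (n - 1) / 2)),
    Real.sqrt_pos.2 (by positivity), fun t ht => ?_⟩
  rw [Real.sqrt_le_left (h.P_pos ht).le, div_le_iff₀ hn, mul_comm _ (n * (n - 1) / 2)]
  refine le_trans ?_ (h.potential_le ht (h.u_pos t ht))
  rw [le_div_iff₀ (h.u_pos t ht)]
  refine le_trans ?_ (h.potential_ge (h.u_pos t ht))
  exact mul_le_of_le_one_right hm.le h.u_le_one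

/-- Since log(1 - ξx²) ≤ 0, log P is at most the Lyapunov function, hence at most its initial value.
-/
theorem exists_P_upper (h : CoupledSystem n ξ lam κ a x y z H Hd s r ρ p) :
    ∃ C > 0, ∀ t ∈ Ici a, H t + conformalRate n ξ (x t) (y t) ≤ C := by
  refine ⟨Real.exp (lyap n ξ x y H a), Real.exp_pos _, fun t ht => ?_⟩
  rw [← Real.log_le_iff_le_exp (h.P_pos ht)]
  have h1 := h.antitoneOn_lyap self_mem_Ici ht ht
  have h2 : Real.log (1 - ξ * x t ^ 2) / (n - 1) ≤ 0 :=
    div_nonpos_of_nonpos_of_nonneg (Real.log_nonpos (h.u_pos t ht).le h.u_le_one)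
      (by linarith [h.one_lt])
  rw [lyap] at h1
  linarith

theorem exists_lyap_lower (h : CoupledSystem n ξ lam κ a x y z H Hd s r ρ p) :
    ∃ m, ∀ t ∈ Ici a, m ≤ lyap n ξ x y H t := by
  obtain ⟨c, hc, hcP⟩ := h.exists_P_lower
  refine ⟨Real.log c, fun t ht => ?_⟩
  have h1 := Real.log_le_log hc (hcP t ht)
  have h2 : Real.log (1 - ξ * x t ^ 2) / (n - 1) ≤ 0 :=
    div_nonpos_of_nonpos_of_nonneg (Real.log_nonpos (h.u_pos t ht).le h.u_le_one)
      (by linarith [h.one_lt])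
  rw [lyap]
  linarith

theorem exists_abs_rate_le (h : CoupledSystem n ξ lam κ a x y z H Hd s r ρ p) :
    ∃ C ≥ 0, ∀ t ∈ Ici a, |conformalRate n ξ (x t) (y t)| ≤ C * |y t| := by
  obtain ⟨c, hc, hcu⟩ := h.exists_u_lower
  have hn : 0 < n - 1 := by linarith [h.one_lt]
  have hξ := h.ξ_pos
  refine ⟨2 * ξ * Real.sqrt (1 / ξ) / ((n - 1) * c), by positivity, fun t ht => ?_⟩
  have hu := h.u_pos t ht
  rw [conformalRate, abs_div, abs_mul, abs_mul, abs_mul, abs_of_pos (mul_pos hn hu), abs_neg,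
    abs_two, abs_of_pos hξ, div_mul_eq_mul_div]
  have h1 := h.abs_x_le hu
  have h2 := hcu t ht
  gcongr

/-- The energy decays at the rate `2 P`, up to an error controlled by the velocity of the field. -/
theorem exists_anisoEnergy_deriv_le (h : CoupledSystem n ξ lam κ a x y z H Hd s r ρ p) :
    ∃ C ≥ 0, ∀ t ∈ Ici a,
      2 * conformalRate n ξ (x t) (y t) * anisoEnergy ξ (x t) (s t) (r t) (ρ t)
        - (H t + conformalRate n ξ (x t) (y t))
          * (n * s t + r t + (n * ρ t + p t) / (1 - ξ * x t ^ 2))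
        + conformalRate n ξ (x t) (y t) * (p t - ρ t) / (1 - ξ * x t ^ 2)
      ≤ (-2 * (H t + conformalRate n ξ (x t) (y t)) + C * |y t|)
        * anisoEnergy ξ (x t) (s t) (r t) (ρ t) := by
  obtain ⟨C, hC, hCy⟩ := h.exists_abs_rate_le
  have hn := h.three_le
  -- The term 2ωW costs 2C|y|W, and ω(p - ρ)/u costs (n+1)C|y|W because |p - ρ| ≤ (n+1)ρ.
  refine ⟨C * (n + 3), by positivity, fun t ht => ?_⟩
  have hu := h.u_pos t ht
  have h1 := hCy t ht
  have hP := h.P_pos ht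
  have hW := h.anisoEnergy_nonneg ht hu
  have hρ := h.ρ_nonneg t ht
  have hs := h.s_nonneg t ht
  have hr := h.r_nonneg t ht
  have hp := abs_le.1 (h.abs_p_le t ht)
  have hst := h.strong t ht
  set om := conformalRate n ξ (x t) (y t)
  set W := anisoEnergy ξ (x t) (s t) (r t) (ρ t) with hWd
  have hρW : ρ t / (1 - ξ * x t ^ 2) ≤ W := by
    rw [hWd, anisoEnergy]
    linarith
  have h2 : 2 * W ≤ n * s t + r t + (n * ρ t + p t) / (1 - ξ * x t ^ 2) := by
    -- The strong energy condition and n ≥ 3 enter here: nρ + p - 2ρ = (ρ + p) + (n - 3)ρ ≥ 0.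
    have h3 : 2 * (ρ t / (1 - ξ * x t ^ 2)) ≤ (n * ρ t + p t) / (1 - ξ * x t ^ 2) := by
      rw [← mul_div_assoc]
      gcongr
      nlinarith
    rw [hWd, anisoEnergy]
    nlinarith
  have h4 : |(p t - ρ t) / (1 - ξ * x t ^ 2)| ≤ (n + 1) * W := by
    rw [abs_div, abs_of_pos hu]
    calc |p t - ρ t| / (1 - ξ * x t ^ 2) ≤ (n + 1) * ρ t / (1 - ξ * x t ^ 2) := by
          gcongr
          rw [abs_le]
          constructor <;> linarith [hp.1, hp.2]
      _ = (n + 1) * (ρ t / (1 - ξ * x t ^ 2)) := by ring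
      _ ≤ _ := by gcongr
  have h5 : om * (p t - ρ t) / (1 - ξ * x t ^ 2) ≤ C * |y t| * ((n + 1) * W) := by
    rw [mul_div_assoc]
    refine (le_abs_self _).trans ?_
    rw [abs_mul]
    gcongr
  have h6 : om * W ≤ C * |y t| * W :=
    mul_le_mul_of_nonneg_right ((le_abs_self _).trans h1) hW
  have h7 := mul_le_mul_of_nonneg_left h2 hP.le
  nlinarith

/-- The velocity is not yet known to tend to 0, but its square is integrable, being dominated by
minus the derivative of the bounded Lyapunov function. The error C|y| therefore spoils the
exponential decay only by a bounded factor. -/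
theorem tendsto_anisoEnergy (h : CoupledSystem n ξ lam κ a x y z H Hd s r ρ p) :
    Tendsto (fun t => anisoEnergy ξ (x t) (s t) (r t) (ρ t)) atTop (𝓝 0) := by
  obtain ⟨C, hC, hCW⟩ := h.exists_anisoEnergy_deriv_le
  obtain ⟨p0, hp0, hP0⟩ := h.exists_P_lower
  obtain ⟨P1, hP1, hP1'⟩ := h.exists_P_upper
  obtain ⟨m, hm⟩ := h.exists_lyap_lower
  have hn : 0 < n - 1 := by linarith [h.one_lt]
  set D := C ^ 2 / (4 * p0) * ((n - 1) * P1) with hD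
  have hD0 : 0 ≤ D := by positivity
  have hle : ∀ t ∈ Ici a, -2 * (H t + conformalRate n ξ (x t) (y t)) + C * |y t|
      ≤ -p0 - D * lyapDeriv n ξ x y H s r ρ p t := by
    intro t ht
    -- Young's inequality, weighted so that half of the damping 2P ≥ 2p0 survives.
    have h1 : C * |y t| ≤ p0 + C ^ 2 / (4 * p0) * y t ^ 2 := by
      have h2 : 0 ≤ (2 * p0 - C * |y t|) ^ 2 / (4 * p0) := by positivity
      have h3 : (2 * p0 - C * |y t|) ^ 2 / (4 * p0)
          = p0 - C * |y t| + C ^ 2 / (4 * p0) * |y t| ^ 2 := by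
        field_simp
        ring
      rw [h3, sq_abs] at h2
      linarith
    have h2 : y t ^ 2 ≤ (n - 1) * P1 * -lyapDeriv n ξ x y H s r ρ p t := by
      have h3 := h.sq_le_dissipation ht (h.u_pos t ht)
      have h4 := (sq_nonneg (y t)).trans h3
      have hP := h.P_pos ht
      rw [lyapDeriv, neg_neg]
      refine h3.trans ?_
      rw [mul_div_assoc', le_div_iff₀ (by positivity), mul_comm]
      have := hP1' t ht
      gcongr
    have h3 := mul_le_mul_of_nonneg_left h2 (show 0 ≤ C ^ 2 / (4 * p0) by positivity)
    have h4 := hP0 t ht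
    rw [hD]
    nlinarith
  have hdecay := le_mul_exp_of_deriv_le (fun t ht => h.hasDeriv_anisoEnergy ht)
    (A := fun t => -p0 * t - D * lyap n ξ x y H t)
    (fun t ht => (((hasDerivWithinAt_id t _).const_mul (-p0)).fun_sub
      ((h.hasDeriv_lyap ht).const_mul D)))
    (fun t ht => (hCW t ht).trans (mul_le_mul_of_nonneg_right (by simpa using hle t ht)
      (h.anisoEnergy_nonneg ht (h.u_pos t ht))))
  have hlim : Tendsto (fun t => anisoEnergy ξ (x a) (s a) (r a) (ρ a)
      * Real.exp (-(-p0 * a - D * lyap n ξ x y H a)) * (Real.exp (-(p0 * t)) * Real.exp (-(D * m))))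
      atTop (𝓝 0) := by
    have h1 : Tendsto (fun t => Real.exp (-(p0 * t))) atTop (𝓝 0) :=
      Real.tendsto_exp_neg_atTop_nhds_zero.comp (tendsto_id.const_mul_atTop hp0)
    simpa using (h1.mul_const (Real.exp (-(D * m)))).const_mul
      (anisoEnergy ξ (x a) (s a) (r a) (ρ a) * Real.exp (-(-p0 * a - D * lyap n ξ x y H a)))
  refine tendsto_of_tendsto_of_tendsto_of_le_of_le' tendsto_const_nhds hlim ?_ ?_
  · filter_upwards [eventually_ge_atTop a] with t ht
    exact h.anisoEnergy_nonneg ht (h.u_pos t ht)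
  · filter_upwards [eventually_ge_atTop a] with t ht
    refine (hdecay t ht).trans ?_
    have h1 := h.anisoEnergy_nonneg self_mem_Ici (h.u_pos a self_mem_Ici)
    refine mul_le_mul_of_nonneg_left ?_ (by positivity)
    rw [← Real.exp_add]
    apply Real.exp_le_exp.2
    have := mul_le_mul_of_nonneg_left (hm t ht) hD0
    linarith

end CoupledSystem

/-! ### Boundedness, and convergence of the velocity and of the potential slope. -/

section Bounded

variable {α : Type*} {l : Filter α} {f g : α → ℝ}

theorem isBigO_one_mul (hf : f =O[l] (fun _ => (1 : ℝ))) (hg : g =O[l] (fun _ => (1 : ℝ))) :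
    (fun t => f t * g t) =O[l] (fun _ => (1 : ℝ)) := by
  simpa using hf.mul hg

theorem isBigO_one_mul_tendsto_zero (hf : f =O[l] (fun _ => (1 : ℝ))) (hg : Tendsto g l (𝓝 0)) :
    Tendsto (fun t => f t * g t) l (𝓝 0) := by
  have := hf.mul_isLittleO ((isLittleO_one_iff ℝ).2 hg)
  simpa using this

theorem isBigO_one_of_abs_le {s : Set α} {C : ℝ} (h : ∀ t ∈ s, |f t| ≤ C) :
    f =O[𝓟 s] (fun _ => (1 : ℝ)) :=
  isBigO_principal.2 ⟨C, fun t ht => by simpa using h t ht⟩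

theorem exists_abs_le_of_isBigO_one {s : Set α} (h : f =O[𝓟 s] (fun _ => (1 : ℝ))) :
    ∃ C, ∀ t ∈ s, |f t| ≤ C := by
  obtain ⟨C, hC⟩ := isBigO_principal.1 h
  exact ⟨C, fun t ht => by simpa using hC t ht⟩

end Bounded

namespace CoupledSystem

variable {n ξ lam κ a : ℝ} {x y z H Hd s r ρ p : ℝ → ℝ} {t : ℝ}

theorem isBigO_const (c : ℝ) : (fun _ : ℝ => c) =O[𝓟 (Ici a)] (fun _ => (1 : ℝ)) :=
  isBigO_one_of_abs_le fun _ _ => le_rfl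

theorem isBigO_x (h : CoupledSystem n ξ lam κ a x y z H Hd s r ρ p) :
    x =O[𝓟 (Ici a)] (fun _ => (1 : ℝ)) :=
  isBigO_one_of_abs_le fun t ht => h.abs_x_le (h.u_pos t ht)

theorem isBigO_y (h : CoupledSystem n ξ lam κ a x y z H Hd s r ρ p) :
    y =O[𝓟 (Ici a)] (fun _ => (1 : ℝ)) := by
  obtain ⟨P1, hP1, hP⟩ := h.exists_P_upper
  have hn := h.one_lt
  refine isBigO_one_of_abs_le (C := Real.sqrt (n * (n - 1) * P1 ^ 2)) fun t ht => ?_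
  apply Real.abs_le_sqrt
  have hu := h.u_pos t ht
  have h1 := h.constraint ht hu
  have h2 := mul_le_mul_of_nonneg_right (h.one_le_kinetic_coeff hu) (sq_nonneg (y t))
  have h3 : 0 < expPotential lam κ (x t) / (1 - ξ * x t ^ 2) :=
    div_pos (mul_pos h.lam_pos (Real.exp_pos _)) hu
  have h4 := h.anisoEnergy_nonneg ht hu
  have h5 : (H t + conformalRate n ξ (x t) (y t)) ^ 2 ≤ P1 ^ 2 :=
    pow_le_pow_left₀ (h.P_pos ht).le (hP t ht) 2
  have h6 : 0 < n * (n - 1) := mul_pos (by linarith) (by linarith)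
  nlinarith

theorem isBigO_P (h : CoupledSystem n ξ lam κ a x y z H Hd s r ρ p) :
    (fun t => H t + conformalRate n ξ (x t) (y t)) =O[𝓟 (Ici a)] (fun _ => (1 : ℝ)) := by
  obtain ⟨P1, hP1, hP⟩ := h.exists_P_upper
  refine isBigO_one_of_abs_le (C := P1) fun t ht => ?_
  rw [abs_of_pos (h.P_pos ht)]
  exact hP t ht

theorem isBigO_H (h : CoupledSystem n ξ lam κ a x y z H Hd s r ρ p) :
    H =O[𝓟 (Ici a)] (fun _ => (1 : ℝ)) := by
  obtain ⟨C, hC, hCy⟩ := h.exists_abs_rate_le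
  have h1 : (fun t => conformalRate n ξ (x t) (y t)) =O[𝓟 (Ici a)] (fun _ => (1 : ℝ)) :=
    (isBigO_principal.2 ⟨C, fun t ht => by simpa using hCy t ht⟩ : _ =O[𝓟 (Ici a)] y).trans
      h.isBigO_y
  simpa using h.isBigO_P.sub h1

theorem isBigO_kinCoeff (h : CoupledSystem n ξ lam κ a x y z H Hd s r ρ p) :
    (fun t => kinCoeff n ξ (x t)) =O[𝓟 (Ici a)] (fun _ => (1 : ℝ)) := by
  have hx2 := isBigO_one_mul h.isBigO_x h.isBigO_x
  have := ((isBigO_const (a := a) 1).sub (isBigO_one_mul (isBigO_const ξ) hx2)).add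
    (isBigO_one_mul (isBigO_const (4 * n * ξ ^ 2 / (n - 1))) hx2)
  refine this.congr_left fun t => ?_
  unfold kinCoeff
  ring

theorem isBigO_exp (h : CoupledSystem n ξ lam κ a x y z H Hd s r ρ p) (c : ℝ) :
    (fun t => Real.exp (c * x t)) =O[𝓟 (Ici a)] (fun _ => (1 : ℝ)) := by
  refine isBigO_one_of_abs_le (C := Real.exp (|c| * Real.sqrt (1 / ξ))) fun t ht => ?_
  rw [Real.abs_exp]
  apply Real.exp_le_exp.2
  refine (le_abs_self _).trans ?_
  rw [abs_mul]
  exact mul_le_mul_of_nonneg_left (h.abs_x_le (h.u_pos t ht)) (abs_nonneg _)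

theorem isBigO_potSlope (h : CoupledSystem n ξ lam κ a x y z H Hd s r ρ p) :
    (fun t => potSlope n ξ κ (x t)) =O[𝓟 (Ici a)] (fun _ => (1 : ℝ)) := by
  have hx2 := isBigO_one_mul h.isBigO_x h.isBigO_x
  have := ((isBigO_const (a := a) (-κ)).add (isBigO_one_mul (isBigO_const (κ * ξ)) hx2)).add
    (isBigO_one_mul (isBigO_const (2 * ((n + 1) / (n - 1)) * ξ)) h.isBigO_x)
  refine this.congr_left fun t => ?_
  unfold potSlope
  ring

theorem density_le (h : CoupledSystem n ξ lam κ a x y z H Hd s r ρ p) (ht : t ∈ Ici a) :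
    ρ t ≤ anisoEnergy ξ (x t) (s t) (r t) (ρ t) := by
  have h1 : ρ t ≤ ρ t / (1 - ξ * x t ^ 2) :=
    le_div_self (h.ρ_nonneg t ht) (h.u_pos t ht) h.u_le_one
  have := h.s_nonneg t ht
  have := h.r_nonneg t ht
  rw [anisoEnergy]
  linarith

theorem shear_le (h : CoupledSystem n ξ lam κ a x y z H Hd s r ρ p) (ht : t ∈ Ici a) :
    s t ≤ 2 * anisoEnergy ξ (x t) (s t) (r t) (ρ t) := by
  have := div_nonneg (h.ρ_nonneg t ht) (h.u_pos t ht).le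
  have := h.r_nonneg t ht
  rw [anisoEnergy]
  linarith

theorem curv_le (h : CoupledSystem n ξ lam κ a x y z H Hd s r ρ p) (ht : t ∈ Ici a) :
    r t ≤ 2 * anisoEnergy ξ (x t) (s t) (r t) (ρ t) := by
  have := div_nonneg (h.ρ_nonneg t ht) (h.u_pos t ht).le
  have := h.s_nonneg t ht
  rw [anisoEnergy]
  linarith

theorem isBigO_anisoEnergy (h : CoupledSystem n ξ lam κ a x y z H Hd s r ρ p) :
    (fun t => anisoEnergy ξ (x t) (s t) (r t) (ρ t)) =O[𝓟 (Ici a)] (fun _ => (1 : ℝ)) := by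
  refine (isBigO_principal.2 ⟨1, fun t ht => ?_⟩ :
    _ =O[𝓟 (Ici a)] fun t => n * (n - 1) / 2 * ((H t + conformalRate n ξ (x t) (y t))
      * (H t + conformalRate n ξ (x t) (y t)))).trans
    (isBigO_one_mul (isBigO_const _) (isBigO_one_mul h.isBigO_P h.isBigO_P))
  have hu := h.u_pos t ht
  rw [← sq, h.constraint ht hu, Real.norm_of_nonneg (h.anisoEnergy_nonneg ht hu), one_mul]
  refine le_trans ?_ (le_abs_self _)
  have h3 : 0 < expPotential lam κ (x t) / (1 - ξ * x t ^ 2) :=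
    div_pos (mul_pos h.lam_pos (Real.exp_pos _)) hu
  have := h.kinetic_nonneg hu (t := t)
  linarith

theorem density_isBigO (h : CoupledSystem n ξ lam κ a x y z H Hd s r ρ p) :
    ρ =O[𝓟 (Ici a)] (fun t => anisoEnergy ξ (x t) (s t) (r t) (ρ t)) :=
  isBigO_principal.2 ⟨1, fun t ht => by
    rw [Real.norm_of_nonneg (h.ρ_nonneg t ht), one_mul]
    exact (h.density_le ht).trans (le_abs_self _)⟩

theorem shear_isBigO (h : CoupledSystem n ξ lam κ a x y z H Hd s r ρ p) :
    s =O[𝓟 (Ici a)] (fun t => anisoEnergy ξ (x t) (s t) (r t) (ρ t)) :=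
  isBigO_principal.2 ⟨2, fun t ht => by
    rw [Real.norm_of_nonneg (h.s_nonneg t ht)]
    exact (h.shear_le ht).trans (mul_le_mul_of_nonneg_left (le_abs_self _) zero_le_two)⟩

theorem curv_isBigO (h : CoupledSystem n ξ lam κ a x y z H Hd s r ρ p) :
    r =O[𝓟 (Ici a)] (fun t => anisoEnergy ξ (x t) (s t) (r t) (ρ t)) :=
  isBigO_principal.2 ⟨2, fun t ht => by
    rw [Real.norm_of_nonneg (h.r_nonneg t ht)]
    exact (h.curv_le ht).trans (mul_le_mul_of_nonneg_left (le_abs_self _) zero_le_two)⟩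

theorem pressure_isBigO (h : CoupledSystem n ξ lam κ a x y z H Hd s r ρ p) :
    p =O[𝓟 (Ici a)] (fun t => anisoEnergy ξ (x t) (s t) (r t) (ρ t)) :=
  (isBigO_principal.2 ⟨n, fun t ht => by
    rw [Real.norm_of_nonneg (h.ρ_nonneg t ht)]
    exact h.abs_p_le t ht⟩ : p =O[𝓟 (Ici a)] ρ).trans h.density_isBigO

/-- The wave equation expresses `kinCoeff * z` through bounded quantities, and `kinCoeff` stays away
from 0. This is the Lipschitz bound on y² that Barbalat's lemma requires. -/
theorem isBigO_z (h : CoupledSystem n ξ lam κ a x y z H Hd s r ρ p) :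
    z =O[𝓟 (Ici a)] (fun _ => (1 : ℝ)) := by
  obtain ⟨c, hc, hcu⟩ := h.exists_u_lower
  have hQ : ∀ t ∈ Ici a, c ≤ kinCoeff n ξ (x t) := fun t ht =>
    (hcu t ht).trans (le_kinCoeff h.one_lt _)
  have h1 : z =O[𝓟 (Ici a)] fun t => kinCoeff n ξ (x t) * z t := by
    refine isBigO_principal.2 ⟨c⁻¹, fun t ht => ?_⟩
    rw [norm_mul, Real.norm_of_nonneg (hc.le.trans (hQ t ht)), ← mul_assoc]
    refine le_mul_of_one_le_left (norm_nonneg _) ?_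
    rw [inv_mul_eq_div, one_le_div hc]
    exact hQ t ht
  refine h1.trans ?_
  have hy2 := isBigO_one_mul h.isBigO_y h.isBigO_y
  have hW := h.isBigO_anisoEnergy
  have h2 := (((isBigO_one_mul (isBigO_one_mul (isBigO_one_mul (isBigO_const (-n)) h.isBigO_H)
      h.isBigO_kinCoeff) h.isBigO_y).sub
    (isBigO_one_mul (isBigO_one_mul (isBigO_const lam) (h.isBigO_exp (-κ))) h.isBigO_potSlope)).add
    (isBigO_one_mul (isBigO_one_mul (isBigO_const (2 * ξ / (n - 1))) h.isBigO_x)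
      (((isBigO_one_mul (isBigO_const ((n - 1) / 2 - 2 * n * ξ)) hy2).add
        (h.pressure_isBigO.trans hW)).sub (h.density_isBigO.trans hW))))
  refine h2.congr' ?_ EventuallyEq.rfl
  filter_upwards [mem_principal_self _] with t ht
  rw [h.wave ht, expPotential]
  ring

/-- Barbalat's lemma for the convergent Lyapunov function, whose derivative is at most minus a
constant multiple of y². -/
theorem tendsto_y (h : CoupledSystem n ξ lam κ a x y z H Hd s r ρ p) :
    Tendsto y atTop (𝓝 0) := by
  obtain ⟨P1, hP1, hP⟩ := h.exists_P_upper
  obtain ⟨m, hm⟩ := h.exists_lyap_lower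
  obtain ⟨l, hl⟩ := tendsto_of_antitoneOn_Ici h.antitoneOn_lyap hm
  obtain ⟨C, hC⟩ := exists_abs_le_of_isBigO_one (isBigO_one_mul (isBigO_const (a := a)
    (2 / ((n - 1) * P1))) (isBigO_one_mul h.isBigO_y h.isBigO_z))
  have hn : 0 < n - 1 := by linarith [h.one_lt]
  have hlip := abs_sub_le_of_hasDerivWithinAt (T := a) (C := C)
    (f := fun t => y t ^ 2 / ((n - 1) * P1))
    (f' := fun t => 2 / ((n - 1) * P1) * (y t * z t))
    (fun t ht => (((h.deriv_y t ht).fun_pow 2).div_const _).congr_deriv (by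
      push_cast
      ring)) hC
  have hlt := fun ε (hε : (0 : ℝ) < ε) => eventually_lt_of_tendsto_of_deriv_le
    (f := lyap n ξ x y H) (e := fun _ => 0) (T := a)
    (fun t ht => h.hasDeriv_lyap ht) hl tendsto_const_nhds
    (fun t ht => by
      rw [add_zero, lyapDeriv, neg_le_neg_iff]
      have h1 := h.sq_le_dissipation ht (h.u_pos t ht)
      have h2 := (sq_nonneg (y t)).trans h1
      have h3 := h.P_pos ht
      have h4 := hP t ht
      gcongr) hlip hε
  have hsq : Tendsto (fun t => y t ^ 2) atTop (𝓝 0) := by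
    rw [tendsto_order]
    constructor
    · exact fun b hb => Eventually.of_forall fun t => hb.trans_le (sq_nonneg _)
    · intro b hb
      filter_upwards [hlt (b / ((n - 1) * P1)) (by positivity)] with t ht
      exact (div_lt_div_iff_of_pos_right (by positivity)).1 ht
  have := hsq.sqrt
  simp only [Real.sqrt_sq_eq_abs, Real.sqrt_zero] at this
  exact (tendsto_zero_iff_abs_tendsto_zero _).2 this

theorem tendsto_density (h : CoupledSystem n ξ lam κ a x y z H Hd s r ρ p) :
    Tendsto ρ atTop (𝓝 0) :=
  (h.density_isBigO.mono (le_principal_iff.2 (Ici_mem_atTop a))).trans_tendsto h.tendsto_anisoEnergy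

theorem tendsto_shear (h : CoupledSystem n ξ lam κ a x y z H Hd s r ρ p) :
    Tendsto s atTop (𝓝 0) :=
  (h.shear_isBigO.mono (le_principal_iff.2 (Ici_mem_atTop a))).trans_tendsto h.tendsto_anisoEnergy

theorem tendsto_curv (h : CoupledSystem n ξ lam κ a x y z H Hd s r ρ p) :
    Tendsto r atTop (𝓝 0) :=
  (h.curv_isBigO.mono (le_principal_iff.2 (Ici_mem_atTop a))).trans_tendsto h.tendsto_anisoEnergy

theorem tendsto_pressure (h : CoupledSystem n ξ lam κ a x y z H Hd s r ρ p) :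
    Tendsto p atTop (𝓝 0) :=
  (h.pressure_isBigO.mono (le_principal_iff.2 (Ici_mem_atTop a))).trans_tendsto
    h.tendsto_anisoEnergy

/-- The weight exp(κx) cancels the exponential in the potential, so the driving force is a constant
times `potSlope`. Every other term contains a factor tending to 0. -/
theorem hasDeriv_momentum (h : CoupledSystem n ξ lam κ a x y z H Hd s r ρ p) (ht : t ∈ Ici a) :
    HasDerivWithinAt (fun t => kinCoeff n ξ (x t) * Real.exp (κ * x t) * y t)
      (-(lam * potSlope n ξ κ (x t)) + Real.exp (κ * x t) *
        (((-2 * ξ + 8 * n * ξ ^ 2 / (n - 1)) * x t + κ * kinCoeff n ξ (x t)) * (y t * y t)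
          + -n * H t * kinCoeff n ξ (x t) * y t
          + 2 * ξ / (n - 1) * x t * (((n - 1) / 2 - 2 * n * ξ) * (y t * y t) + p t - ρ t)))
      (Ici a) t := by
  refine (((h.hasDeriv_kinCoeff ht).fun_mul (((h.deriv_x t ht).const_mul κ).exp)).fun_mul
    (h.deriv_y t ht)).congr_deriv ?_
  have h1 : Real.exp (κ * x t) * expPotential lam κ (x t) = lam := by
    rw [expPotential, mul_left_comm, ← Real.exp_add]
    simp
  linear_combination Real.exp (κ * x t) * h.wave ht - potSlope n ξ κ (x t) * h1

theorem tendsto_potSlope (h : CoupledSystem n ξ lam κ a x y z H Hd s r ρ p) :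
    Tendsto (fun t => potSlope n ξ κ (x t)) atTop (𝓝 0) := by
  have hle : (atTop : Filter ℝ) ≤ 𝓟 (Ici a) := le_principal_iff.2 (Ici_mem_atTop a)
  have hy := h.tendsto_y
  have hyy : Tendsto (fun t => y t * y t) atTop (𝓝 0) := by simpa using hy.mul hy
  have hx := h.isBigO_x.mono hle
  have hQ := h.isBigO_kinCoeff.mono hle
  have hexp := (h.isBigO_exp κ).mono hle
  have hc := fun c : ℝ => (isBigO_const (a := a) c).mono hle
  have hf : Tendsto (fun t => kinCoeff n ξ (x t) * Real.exp (κ * x t) * y t) atTop (𝓝 0) :=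
    isBigO_one_mul_tendsto_zero (isBigO_one_mul hQ hexp) hy
  have he : Tendsto (fun t => Real.exp (κ * x t) *
        (((-2 * ξ + 8 * n * ξ ^ 2 / (n - 1)) * x t + κ * kinCoeff n ξ (x t)) * (y t * y t)
          + -n * H t * kinCoeff n ξ (x t) * y t
          + 2 * ξ / (n - 1) * x t * (((n - 1) / 2 - 2 * n * ξ) * (y t * y t) + p t - ρ t)))
      atTop (𝓝 0) := by
    refine isBigO_one_mul_tendsto_zero hexp ?_
    have h1 := isBigO_one_mul_tendsto_zero ((isBigO_one_mul
      (hc (-2 * ξ + 8 * n * ξ ^ 2 / (n - 1))) hx).add (isBigO_one_mul (hc κ) hQ)) hyy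
    have h2 := isBigO_one_mul_tendsto_zero (isBigO_one_mul (isBigO_one_mul (hc (-n))
      (h.isBigO_H.mono hle)) hQ) hy
    have h3 := isBigO_one_mul_tendsto_zero (isBigO_one_mul (hc (2 * ξ / (n - 1))) hx)
      (g := fun t => ((n - 1) / 2 - 2 * n * ξ) * (y t * y t) + p t - ρ t) (by
        simpa using ((hyy.const_mul ((n - 1) / 2 - 2 * n * ξ)).add h.tendsto_pressure).sub
          h.tendsto_density)
    simpa using (h1.add h2).add h3
  obtain ⟨C, hC⟩ := exists_abs_le_of_isBigO_one (isBigO_one_mul (isBigO_const (a := a) lam)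
    (isBigO_one_mul ((isBigO_one_mul (isBigO_const (2 * κ * ξ)) h.isBigO_x).add
      (isBigO_const (2 * ((n + 1) / (n - 1)) * ξ))) h.isBigO_y))
  have hlip := abs_sub_le_of_hasDerivWithinAt (T := a) (C := C)
    (f := fun t => lam * potSlope n ξ κ (x t)) (fun t ht => by
      refine (((((h.hasDeriv_u ht).const_mul (-κ)).fun_add ((h.deriv_x t ht).const_mul
        (2 * ((n + 1) / (n - 1)) * ξ)))).const_mul lam).congr_deriv ?_
      ring) hC
  have h1 := fun ε (hε : (0 : ℝ) < ε) => eventually_lt_of_tendsto_of_deriv_le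
    (T := a) (fun t ht => h.hasDeriv_momentum ht) hf he (fun t _ => le_rfl) hlip hε
  have hen := he.neg
  rw [neg_zero] at hen
  -- `potSlope` has no sign, and Barbalat's lemma bounds it only from above; the negated momentum
  -- gives the bound from below.
  have h2 := fun ε (hε : (0 : ℝ) < ε) => eventually_lt_of_tendsto_of_deriv_le
    (T := a) (G := fun t => -(lam * potSlope n ξ κ (x t))) (M := C)
    (fun t ht => (h.hasDeriv_momentum ht).fun_neg) hf.neg hen
    (fun t _ => (neg_add _ _).le) (fun t ht q hq => by
      rw [← abs_neg]
      convert hlip t ht q hq using 2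
      ring) hε
  have hlam := h.lam_pos
  rw [Metric.tendsto_nhds]
  intro ε hε
  filter_upwards [h1 (lam * ε) (by positivity), h2 (lam * ε) (by positivity)] with t ht1 ht2
  rw [Real.dist_eq, sub_zero, abs_lt]
  constructor <;> nlinarith

end CoupledSystem

/-! ### The critical point of the Einstein-frame potential. -/

section FieldLimit

variable {n : ℕ} {ξ lam κ : ℝ}

/-- Factorization of a quadratic over its two roots, the larger of which is `fieldLimit`. -/
theorem potSlope_eq (hξ : 0 < ξ) (hκ : 0 < κ) (x : ℝ) :
    potSlope n ξ κ x = κ * ξ * (x - fieldLimit n ξ κ)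
      * (x + 1 / κ * (((n : ℝ) + 1) / ((n : ℝ) - 1))
        + Real.sqrt (1 / ξ + 1 / κ ^ 2 * (((n : ℝ) + 1) / ((n : ℝ) - 1)) ^ 2)) := by
  have h1 := Real.sq_sqrt (show 0 ≤ 1 / ξ + 1 / κ ^ 2 * (((n : ℝ) + 1) / ((n : ℝ) - 1)) ^ 2 by
    positivity)
  rw [fieldLimit, potSlope]
  generalize ((n : ℝ) + 1) / ((n : ℝ) - 1) = m at *
  generalize Real.sqrt (1 / ξ + 1 / κ ^ 2 * m ^ 2) = R at *
  have h2 : κ * ξ * R ^ 2 = κ + ξ / κ * m ^ 2 := by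
    rw [h1]
    field_simp
  have h3 : κ * ξ * (1 / κ * m) ^ 2 = ξ / κ * m ^ 2 := by field_simp
  have h4 : κ * (1 / κ) = 1 := by field_simp
  linear_combination h2 - h3 - 2 * ξ * x * m * h4

theorem fieldLimit_pos (hξ : 0 < ξ) (hκ : 0 < κ) (hn : 1 < (n : ℝ)) : 0 < fieldLimit n ξ κ := by
  have hm : 0 < 1 / κ * (((n : ℝ) + 1) / ((n : ℝ) - 1)) := by
    have : 0 < (n : ℝ) - 1 := by linarith
    positivity
  rw [fieldLimit, sub_pos]
  apply Real.lt_sqrt_of_sq_lt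
  have : 0 < 1 / ξ := by positivity
  rw [mul_pow, div_pow 1 κ, one_pow]
  linarith

theorem potSlope_fieldLimit (hξ : 0 < ξ) (hκ : 0 < κ) : potSlope n ξ κ (fieldLimit n ξ κ) = 0 := by
  rw [potSlope_eq hξ hκ]
  simp

/-- Vanishing of the slope says that κ(1 - ξφ_∞²) is a positive multiple of φ_∞ > 0. -/
theorem one_sub_fieldLimit_pos (hξ : 0 < ξ) (hκ : 0 < κ) (hn : 1 < (n : ℝ)) :
    0 < 1 - ξ * fieldLimit n ξ κ ^ 2 := by
  have h1 := potSlope_fieldLimit (n := n) hξ hκ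
  have h2 := fieldLimit_pos hξ hκ hn
  have h3 : 0 < (n : ℝ) - 1 := by linarith
  rw [potSlope] at h1
  have h4 : 0 < 2 * (((n : ℝ) + 1) / ((n : ℝ) - 1)) * ξ * fieldLimit n ξ κ := by positivity
  refine pos_of_mul_pos_right (a := κ) ?_ hκ.le
  linarith

theorem hubbleLimit_arg_pos (hξ : 0 < ξ) (hlam : 0 < lam) (hκ : 0 < κ) (hn : 1 < (n : ℝ)) :
    0 < 2 / ((n : ℝ) * ((n : ℝ) - 1)) *
      (expPotential lam κ (fieldLimit n ξ κ) / (1 - ξ * fieldLimit n ξ κ ^ 2)) := by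
  have h3 : 0 < (n : ℝ) - 1 := by linarith
  have := one_sub_fieldLimit_pos hξ hκ hn
  have : 0 < expPotential lam κ (fieldLimit n ξ κ) := mul_pos hlam (Real.exp_pos _)
  positivity

theorem hubbleLimit_pos (hξ : 0 < ξ) (hlam : 0 < lam) (hκ : 0 < κ) (hn : 1 < (n : ℝ)) :
    0 < hubbleLimit n ξ lam κ :=
  Real.sqrt_pos.2 (hubbleLimit_arg_pos hξ hlam hκ hn)

end FieldLimit

/-! ### Limits of the system and the sharp decay rate. -/

namespace CoupledSystem

variable {n : ℕ} {ξ lam κ a : ℝ} {x y z H Hd s r ρ p : ℝ → ℝ} {t : ℝ}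

theorem tendsto_x (h : CoupledSystem n ξ lam κ a x y z H Hd s r ρ p) :
    Tendsto x atTop (𝓝 (fieldLimit n ξ κ)) := by
  have hn1 : 0 < (n : ℝ) - 1 := by linarith [h.one_lt]
  have hξ := h.ξ_pos
  have hκ := h.κ_pos
  set m := ((n : ℝ) + 1) / ((n : ℝ) - 1) with hm
  have hm0 : 0 < m := by positivity
  have hle : ∀ t ∈ Ici a, |x t - fieldLimit n ξ κ| ≤ (ξ * m)⁻¹ * |potSlope n ξ κ (x t)| := by
    intro t ht
    have h1 := (abs_le.1 (h.abs_x_le (h.u_pos t ht))).1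
    have h2 : Real.sqrt (1 / ξ) ≤ Real.sqrt (1 / ξ + 1 / κ ^ 2 * m ^ 2) := by
      apply Real.sqrt_le_sqrt
      have : 0 ≤ 1 / κ ^ 2 * m ^ 2 := by positivity
      linarith
    -- The second root lies below -1/√ξ by at least m/κ, while x ≥ -1/√ξ; the cofactor is therefore
    -- bounded below and smallness of the slope forces x near `fieldLimit`.
    have h3 : 1 / κ * m ≤ x t + 1 / κ * m + Real.sqrt (1 / ξ + 1 / κ ^ 2 * m ^ 2) := by linarith
    have h4 : 0 < 1 / κ * m := by positivity
    rw [potSlope_eq hξ hκ, ← hm, abs_mul, abs_mul, abs_of_pos (mul_pos hκ hξ),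
      abs_of_pos (h4.trans_le h3), inv_mul_eq_div, le_div_iff₀ (by positivity)]
    calc |x t - fieldLimit n ξ κ| * (ξ * m)
        = κ * ξ * |x t - fieldLimit n ξ κ| * (1 / κ * m) := by field_simp
      _ ≤ _ := by gcongr
  rw [tendsto_iff_norm_sub_tendsto_zero]
  have h0 : Tendsto (fun t => (ξ * m)⁻¹ * |potSlope n ξ κ (x t)|) atTop (𝓝 0) := by
    simpa using h.tendsto_potSlope.abs.const_mul (ξ * m)⁻¹
  refine squeeze_zero' (Eventually.of_forall fun t => norm_nonneg _) ?_ h0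
  filter_upwards [eventually_ge_atTop a] with t ht
  exact hle t ht

theorem limit_pos (h : CoupledSystem n ξ lam κ a x y z H Hd s r ρ p) :
    0 < 1 - ξ * fieldLimit n ξ κ ^ 2 :=
  one_sub_fieldLimit_pos h.ξ_pos h.κ_pos h.one_lt

theorem tendsto_u (h : CoupledSystem n ξ lam κ a x y z H Hd s r ρ p) :
    Tendsto (fun t => 1 - ξ * x t ^ 2) atTop (𝓝 (1 - ξ * fieldLimit n ξ κ ^ 2)) :=
  ((h.tendsto_x.pow 2).const_mul ξ).const_sub 1

theorem tendsto_kinCoeff (h : CoupledSystem n ξ lam κ a x y z H Hd s r ρ p) :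
    Tendsto (fun t => kinCoeff n ξ (x t)) atTop (𝓝 (kinCoeff n ξ (fieldLimit n ξ κ))) :=
  h.tendsto_u.add (((h.tendsto_x.pow 2).const_mul _).div_const _)

theorem tendsto_potential (h : CoupledSystem n ξ lam κ a x y z H Hd s r ρ p) :
    Tendsto (fun t => expPotential lam κ (x t)) atTop
      (𝓝 (expPotential lam κ (fieldLimit n ξ κ))) :=
  ((Real.continuous_exp.tendsto _).comp (h.tendsto_x.const_mul (-κ))).const_mul lam

theorem tendsto_kinetic (h : CoupledSystem n ξ lam κ a x y z H Hd s r ρ p) :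
    Tendsto (fun t => kinCoeff n ξ (x t) / (1 - ξ * x t ^ 2) ^ 2 * y t ^ 2) atTop (𝓝 0) := by
  simpa using (h.tendsto_kinCoeff.div (h.tendsto_u.pow 2) (pow_ne_zero 2 h.limit_pos.ne')).mul
    (h.tendsto_y.pow 2)

/-- In the constraint only the potential term survives in the limit; P is the positive square root.
-/
theorem tendsto_P (h : CoupledSystem n ξ lam κ a x y z H Hd s r ρ p) :
    Tendsto (fun t => H t + conformalRate n ξ (x t) (y t)) atTop
      (𝓝 (hubbleLimit n ξ lam κ)) := by
  have hn := h.one_lt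
  have hn1 : 0 < (n : ℝ) - 1 := by linarith
  have h1 := ((((h.tendsto_kinetic.div_const 2).add (h.tendsto_potential.div h.tendsto_u
    h.limit_pos.ne')).add h.tendsto_anisoEnergy).const_mul (2 / ((n : ℝ) * ((n : ℝ) - 1)))).sqrt
  simp only [zero_div, zero_add, add_zero] at h1
  refine Tendsto.congr' ?_ h1
  filter_upwards [eventually_ge_atTop a] with t ht
  have hu := h.u_pos t ht
  have h2 := h.constraint ht hu
  simp only [Pi.div_apply]
  rw [← h2, ← mul_assoc, show 2 / ((n : ℝ) * ((n : ℝ) - 1)) * ((n : ℝ) * ((n : ℝ) - 1) / 2) = 1 by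
    field_simp, one_mul, Real.sqrt_sq (h.P_pos ht).le]

theorem tendsto_rate (h : CoupledSystem n ξ lam κ a x y z H Hd s r ρ p) :
    Tendsto (fun t => conformalRate n ξ (x t) (y t)) atTop (𝓝 0) := by
  have hn1 : (n : ℝ) - 1 ≠ 0 := by linarith [h.one_lt]
  have := ((h.tendsto_x.const_mul (-2 * ξ)).mul h.tendsto_y).div
    (h.tendsto_u.const_mul ((n : ℝ) - 1)) (mul_ne_zero hn1 h.limit_pos.ne')
  rw [mul_zero, zero_div] at this
  exact this

theorem tendsto_H (h : CoupledSystem n ξ lam κ a x y z H Hd s r ρ p) :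
    Tendsto H atTop (𝓝 (hubbleLimit n ξ lam κ)) := by
  simpa using h.tendsto_P.sub h.tendsto_rate

theorem tendsto_z (h : CoupledSystem n ξ lam κ a x y z H Hd s r ρ p) :
    Tendsto z atTop (𝓝 0) := by
  have hQ : 0 < kinCoeff n ξ (fieldLimit n ξ κ) := h.limit_pos.trans_le (le_kinCoeff h.one_lt _)
  have h1 := (((((h.tendsto_H.const_mul (-(n : ℝ))).mul h.tendsto_kinCoeff).mul h.tendsto_y).sub
    (h.tendsto_potential.mul h.tendsto_potSlope)).add (((h.tendsto_x.const_mul (2 * ξ)).div_const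
      ((n : ℝ) - 1)).mul ((((h.tendsto_y.pow 2).const_mul (((n : ℝ) - 1) / 2 - 2 * n * ξ)).add
        h.tendsto_pressure).sub h.tendsto_density))).div h.tendsto_kinCoeff hQ.ne'
  simp only [ne_eq, OfNat.ofNat_ne_zero, not_false_eq_true, zero_pow, mul_zero, sub_zero, add_zero,
    zero_div] at h1
  refine Tendsto.congr' ?_ h1
  filter_upwards [eventually_ge_atTop a] with t ht
  have hQt : kinCoeff n ξ (x t) ≠ 0 :=
    ((h.u_pos t ht).trans_le (le_kinCoeff h.one_lt _)).ne'
  simp only [Pi.div_apply]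
  rw [div_eq_iff hQt, mul_comm (z t), h.wave ht]

theorem tendsto_dissipation (h : CoupledSystem n ξ lam κ a x y z H Hd s r ρ p) :
    Tendsto (fun t => dissipation n ξ (x t) (y t) (s t) (r t) (ρ t) (p t)) atTop (𝓝 0) := by
  have := (((h.tendsto_kinetic.add h.tendsto_shear).add (h.tendsto_curv.div_const (n : ℝ))).add
    ((h.tendsto_density.add (h.tendsto_pressure.div_const (n : ℝ))).div h.tendsto_u
      h.limit_pos.ne'))
  simp only [zero_div, add_zero] at this
  exact this

theorem tendsto_Hd (h : CoupledSystem n ξ lam κ a x y z H Hd s r ρ p) :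
    Tendsto Hd atTop (𝓝 0) := by
  have hn1 : (n : ℝ) - 1 ≠ 0 := by linarith [h.one_lt]
  have h1 := (((h.tendsto_rate.mul h.tendsto_P).sub (h.tendsto_dissipation.div_const
    ((n : ℝ) - 1))).add ((((h.tendsto_y.pow 2).add (h.tendsto_x.mul h.tendsto_z)).const_mul
      (2 * ξ)).div (h.tendsto_u.const_mul ((n : ℝ) - 1)) (mul_ne_zero hn1 h.limit_pos.ne'))).add
    ((((h.tendsto_x.pow 2).const_mul (4 * ξ ^ 2)).mul (h.tendsto_y.pow 2)).div
      ((h.tendsto_u.pow 2).const_mul ((n : ℝ) - 1))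
      (mul_ne_zero hn1 (pow_ne_zero 2 h.limit_pos.ne')))
  simp only [ne_eq, OfNat.ofNat_ne_zero, not_false_eq_true, zero_pow, mul_zero, zero_mul, sub_zero,
    add_zero, zero_div] at h1
  refine Tendsto.congr' ?_ h1
  filter_upwards [eventually_ge_atTop a] with t ht
  have h2 := raychaudhuri_conformal h.one_lt (h.u_pos t ht) (h.hamiltonian t ht) (h.trace t ht)
  simp only [Pi.div_apply]
  rw [dissipation, ← h2]
  ring

/-- The logarithmic rate -2P + C|y| now converges to -2H_∞, so beyond some `T` it is below -(2 -
δ)H_∞, and Gronwall's inequality is applied from `T` on. -/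
theorem anisoEnergy_isBigO (h : CoupledSystem n ξ lam κ a x y z H Hd s r ρ p) {δ : ℝ}
    (hδ : 0 < δ) :
    (fun t => anisoEnergy ξ (x t) (s t) (r t) (ρ t))
      =O[atTop] fun t => Real.exp (-(2 - δ) * hubbleLimit n ξ lam κ * t) := by
  obtain ⟨C, hC, hCW⟩ := h.exists_anisoEnergy_deriv_le
  have hHpos := hubbleLimit_pos h.ξ_pos h.lam_pos h.κ_pos h.one_lt
  have h1 : Tendsto (fun t => -2 * (H t + conformalRate n ξ (x t) (y t)) + C * |y t|) atTop
      (𝓝 (-2 * hubbleLimit n ξ lam κ + C * |0|)) :=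
    (h.tendsto_P.const_mul (-2)).add (h.tendsto_y.abs.const_mul C)
  obtain ⟨T, hT⟩ := eventually_atTop.1 ((h1.eventually_lt_const
    (show -2 * hubbleLimit n ξ lam κ + C * |0| < -(2 - δ) * hubbleLimit n ξ lam κ by
      rw [abs_zero]
      nlinarith)).and (eventually_ge_atTop a))
  have hTa := (hT T le_rfl).2
  have hdecay := le_mul_exp_of_deriv_le (a := T)
    (fun t ht => (h.hasDeriv_anisoEnergy (hTa.trans ht)).mono (Ici_subset_Ici.2 hTa))
    (A := fun t => -(2 - δ) * hubbleLimit n ξ lam κ * t)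
    (fun t _ => (hasDerivWithinAt_id t _).const_mul _)
    (fun t ht => (hCW t (hTa.trans ht)).trans (mul_le_mul_of_nonneg_right
      (by simpa using (hT t ht).1.le)
      (h.anisoEnergy_nonneg (hTa.trans ht) (h.u_pos t (hTa.trans ht)))))
  refine IsBigO.of_bound (anisoEnergy ξ (x T) (s T) (r T) (ρ T)
    * Real.exp (-(-(2 - δ) * hubbleLimit n ξ lam κ * T))) ?_
  filter_upwards [eventually_ge_atTop T] with t ht
  rw [Real.norm_of_nonneg (h.anisoEnergy_nonneg (hTa.trans ht) (h.u_pos t (hTa.trans ht))),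
    Real.norm_of_nonneg (Real.exp_pos _).le]
  exact hdecay t ht

end CoupledSystem

/-! ### From the field equations to the scalar system. -/

section Reduction

variable {n : ℕ} {𝔤 : Type*} [LieRing 𝔤] [LieAlgebra ℝ 𝔤] {b : Module.Basis (Fin n) ℝ 𝔤}
  {I : Set ℝ} {ξ lam κ : ℝ} {V : ℝ → ℝ} {γ : ℝ → Matrix (Fin n) (Fin n) ℝ} {φ ρ : ℝ → ℝ}
  {j : ℝ → Fin n → ℝ} {S : ℝ → Matrix (Fin n) (Fin n) ℝ} {t : ℝ}

theorem metricTrace_secondForm (hn : n ≠ 0) (I : Set ℝ) (γ : ℝ → Matrix (Fin n) (Fin n) ℝ)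
    (t : ℝ) : metricTrace (γ t) (secondForm I γ t) = -(n * hubble I γ t) := by
  have : (n : ℝ) ≠ 0 := by exact_mod_cast hn
  rw [hubble]
  field_simp

theorem derivWithin_metricTrace_secondForm (hn : n ≠ 0) (I : Set ℝ)
    (γ : ℝ → Matrix (Fin n) (Fin n) ℝ) (t : ℝ) :
    derivWithin (fun s => metricTrace (γ s) (secondForm I γ s)) I t
      = -(n * derivWithin (hubble I γ) I t) := by
  simp only [metricTrace_secondForm hn]
  rw [derivWithin.fun_neg, derivWithin_const_mul_field]

namespace IsMetricCurve

theorem hasDerivWithinAt_hubble (hγ : IsMetricCurve I γ) (ht : t ∈ I) :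
    HasDerivWithinAt (hubble I γ) (derivWithin (hubble I γ) I t) I t :=
  ((hγ.hasDerivWithinAt_metricTrace ht).differentiableWithinAt.fun_neg.div_const
    (n : ℝ)).hasDerivWithinAt

theorem trace_sq_secondForm (hn : n ≠ 0) (hγ : IsMetricCurve I γ) (ht : t ∈ I) :
    ((γ t)⁻¹ * secondForm I γ t * (γ t)⁻¹ * secondForm I γ t).trace
      = tensorNormSq (γ t) (shear I γ t) + n * hubble I γ t ^ 2 := by
  rw [hγ.tensorNormSq_shear hn ht]
  ring

theorem ricci_inl_inl_eq (hn : n ≠ 0) (hγ : IsMetricCurve I γ) (ht : t ∈ I) :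
    (spacetimeFrame b I).ricci (spacetimeMetric γ) (.inl ()) (.inl ()) t
      = -(n * derivWithin (hubble I γ) I t) - tensorNormSq (γ t) (shear I γ t)
        - n * hubble I γ t ^ 2 := by
  rw [ricci_inl_inl b hγ ht, derivWithin_metricTrace_secondForm hn, hγ.trace_sq_secondForm hn ht]
  ring

theorem spacetime_scalarCurv (hn : n ≠ 0) (hγ : IsMetricCurve I γ) (ht : t ∈ I) :
    (spacetimeFrame b I).scalarCurv (spacetimeMetric γ) t
      = 2 * n * derivWithin (hubble I γ) I t + n * (n + 1) * hubble I γ t ^ 2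
        + tensorNormSq (γ t) (shear I γ t) - -groupScalarCurv b (γ t) := by
  rw [scalarCurv_eq b hγ ht, derivWithin_metricTrace_secondForm hn, hγ.trace_sq_secondForm hn ht,
    metricTrace_secondForm hn]
  ring

theorem spacetime_box (hn : n ≠ 0) (hγ : IsMetricCurve I γ) (ht : t ∈ I) (φ : ℝ → ℝ) :
    (spacetimeFrame b I).box (spacetimeMetric γ) φ t
      = -derivWithin (derivWithin φ I) I t - n * hubble I γ t * derivWithin φ I t := by
  rw [box_eq b hγ ht, metricTrace_secondForm hn]
  ring

theorem sum_inv_mul_metric (hγ : IsMetricCurve I γ) (ht : t ∈ I) :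
    ∑ x, ∑ y, (spacetimeMetric γ t)⁻¹ x y * spacetimeMetric γ t x y = n + 1 := by
  rw [sum_inv_mul_inv (hγ.isUnit_det ht) (spacetimeMetric γ t)]
  have : ∑ i, ∑ l, (γ t)⁻¹ i l * spacetimeMetric γ t (.inr i) (.inr l) = n := by
    simp only [spacetimeMetric, fromBlocks_apply₂₂]
    rw [Matrix.sum_sum_mul_eq_trace, hγ.isSymm ht, Matrix.nonsing_inv_mul _ (hγ.isUnit_det ht)]
    simp
  rw [this]
  simp [spacetimeMetric, add_comm]

theorem sum_inv_mul_stressEnergy (hγ : IsMetricCurve I γ) (ht : t ∈ I) (hS : (S t).IsSymm) :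
    ∑ x, ∑ y, (spacetimeMetric γ t)⁻¹ x y * stressEnergy ρ j S t x y
      = -ρ t + metricTrace (γ t) (S t) := by
  rw [sum_inv_mul_inv (hγ.isUnit_det ht) (stressEnergy ρ j S t)]
  simp only [stressEnergy, fromBlocks_apply₂₂, fromBlocks_apply₁₁, of_apply]
  rw [Matrix.sum_sum_mul_eq_trace, hS.eq, metricTrace]

end IsMetricCurve

namespace IsCoupledSolution

theorem differentiableOn_derivWithin {f : ℝ → ℝ} (hI : UniqueDiffOn ℝ I) (hf : ContDiffOn ℝ 2 f I) :
    DifferentiableOn ℝ (derivWithin f I) I :=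
  (hf.derivWithin hI (m := 1) (by norm_num)).differentiableOn one_ne_zero

theorem isMetricCurve (hI : UniqueDiffOn ℝ I) (h : IsCoupledSolution b I ξ V γ φ ρ j S) :
    IsMetricCurve I γ where
  uniqueDiffOn := hI
  differentiableOn i l := (h.contDiff_metric i l).differentiableOn two_ne_zero
  differentiableOn_secondForm i l :=
    (differentiableOn_derivWithin hI (h.contDiff_metric i l)).const_mul _
  posDef := h.posDef_metric

/-- This is the time-time component: the second derivatives of metric and field cancel, leaving a
constraint. -/
theorem hamiltonianEq (hn : n ≠ 0) (hI : UniqueDiffOn ℝ I)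
    (h : IsCoupledSolution b I ξ V γ φ ρ j S) (ht : t ∈ I) :
    HamiltonianEq n ξ (φ t) (derivWithin φ I t) (hubble I γ t)
      (tensorNormSq (γ t) (shear I γ t)) (-groupScalarCurv b (γ t)) (ρ t) (V (φ t)) := by
  have hγ := h.isMetricCurve hI
  have h1 := h.einstein t ht (.inl ()) (.inl ())
  simp only [hγ.ricci_inl_inl_eq hn ht, hγ.spacetime_scalarCurv hn ht, hγ.spacetime_box hn ht,
    IsMetricCurve.gradSq_eq b (hγ.isUnit_det ht), IsMetricCurve.hess_inl_inl b (hγ.isUnit_det ht)]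
    at h1
  have h2 : spacetimeMetric γ t (.inl ()) (.inl ()) = -1 := by simp [spacetimeMetric]
  have h3 : stressEnergy ρ j S t (.inl ()) (.inl ()) = ρ t := rfl
  have h4 : (spacetimeFrame b I).grad φ (.inl ()) t = derivWithin φ I t := rfl
  rw [h2, h3, h4] at h1
  unfold HamiltonianEq
  linear_combination h1

/-- Contraction with the inverse space-time metric; that metric is block diagonal, so the flow `j`
drops out. -/
theorem traceEq (hn : n ≠ 0) (hI : UniqueDiffOn ℝ I)
    (h : IsCoupledSolution b I ξ V γ φ ρ j S) (ht : t ∈ I) :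
    TraceEq n ξ (φ t) (derivWithin φ I t)
      (-derivWithin (derivWithin φ I) I t - n * hubble I γ t * derivWithin φ I t)
      (2 * n * derivWithin (hubble I γ) I t + n * (n + 1) * hubble I γ t ^ 2
        + tensorNormSq (γ t) (shear I γ t) - -groupScalarCurv b (γ t))
      (ρ t) (metricTrace (γ t) (S t)) (V (φ t)) := by
  have hγ := h.isMetricCurve hI
  have h1 := hγ.spacetime_box (b := b) hn ht φ
  have h2 := hγ.spacetime_scalarCurv (b := b) hn ht
  have h3 := IsMetricCurve.gradSq_eq b (I := I) (hγ.isUnit_det ht) φ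
  have h4 := hγ.sum_inv_mul_metric ht
  have h5 := hγ.sum_inv_mul_stressEnergy (ρ := ρ) (j := j) ht (h.symm_pressure t ht)
  have h6 := h.einstein t ht
  simp only at h6
  set F := spacetimeFrame b I
  set g := spacetimeMetric γ
  have h7 : ∑ x, ∑ y, (g t)⁻¹ x y
        * ((1 - ξ * φ t ^ 2) * (F.ricci g x y t - 1 / 2 * F.scalarCurv g t * g t x y))
      = (1 - ξ * φ t ^ 2) * (F.scalarCurv g t - 1 / 2 * F.scalarCurv g t * (n + 1)) := by
    rw [← h4]
    nth_rewrite 2 [Frame.scalarCurv]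
    simp only [Finset.mul_sum, ← Finset.sum_sub_distrib]
    exact Finset.sum_congr rfl fun _ _ => Finset.sum_congr rfl fun _ _ => by ring
  have h8 : ∑ x, ∑ y, (g t)⁻¹ x y * ((1 - 2 * ξ) * (F.grad φ x t * F.grad φ y t)
        + (2 * ξ - 1 / 2) * F.gradSq g φ t * g t x y
        - 2 * ξ * φ t * F.hess g φ x y t
        + 2 * ξ * (φ t * F.box g φ t) * g t x y
        - V (φ t) * g t x y
        + stressEnergy ρ j S t x y)
      = (1 - 2 * ξ) * F.gradSq g φ t + (2 * ξ - 1 / 2) * F.gradSq g φ t * (n + 1)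
        - 2 * ξ * φ t * F.box g φ t + 2 * ξ * (φ t * F.box g φ t) * (n + 1) - V (φ t) * (n + 1)
        + (-ρ t + metricTrace (γ t) (S t)) := by
    rw [← h4, ← h5]
    nth_rewrite 2 [Frame.gradSq]
    nth_rewrite 2 [Frame.box]
    simp only [Finset.mul_sum, ← Finset.sum_sub_distrib, ← Finset.sum_add_distrib]
    exact Finset.sum_congr rfl fun _ _ => Finset.sum_congr rfl fun _ _ => by ring
  simp only [h6] at h7
  rw [h8, h1, h2, h3] at h7
  unfold TraceEq
  linear_combination -h7

theorem fieldEq (hn : n ≠ 0) (hI : UniqueDiffOn ℝ I)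
    (h : IsCoupledSolution b I ξ (expPotential lam κ) γ φ ρ j S) (ht : t ∈ I) :
    FieldEq ξ κ (φ t)
      (-derivWithin (derivWithin φ I) I t - n * hubble I γ t * derivWithin φ I t)
      (2 * n * derivWithin (hubble I γ) I t + n * (n + 1) * hubble I γ t ^ 2
        + tensorNormSq (γ t) (shear I γ t) - -groupScalarCurv b (γ t))
      (expPotential lam κ (φ t)) := by
  have hγ := h.isMetricCurve hI
  have h1 := h.field t ht
  have h2 : deriv (expPotential lam κ) (φ t) = -κ * expPotential lam κ (φ t) := by
    have := ((((hasDerivAt_id (φ t)).const_mul (-κ)).exp).const_mul lam).deriv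
    unfold expPotential
    simp only [id] at this
    rw [this]
    ring
  simp only [hγ.spacetime_scalarCurv hn ht, hγ.spacetime_box hn ht, h2] at h1
  unfold FieldEq
  linear_combination h1

theorem coupledSystem (hn : 3 ≤ n)
    (hG : ∀ h : Matrix (Fin n) (Fin n) ℝ, h.PosDef → groupScalarCurv b h ≤ 0)
    (hξ : 0 < ξ) (hlam : 0 < lam) (hκ : 0 < κ) {t₀ : ℝ}
    (hsol : IsCoupledSolution b (Ici t₀) ξ (expPotential lam κ) γ φ ρ j S)
    (hDEC : ∀ t ∈ Ici t₀, DominantEnergy (γ t) (ρ t) (j t) (S t))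
    (hSEC : ∀ t ∈ Ici t₀, StrongEnergy (γ t) (ρ t) (S t))
    (hφ₀ : 0 < 1 - ξ * φ t₀ ^ 2)
    (hH₀ : -derivWithin (fun t => Real.log (conformalFactor n ξ φ t)) (Ici t₀) t₀
      < hubble (Ici t₀) γ t₀) :
    CoupledSystem n ξ lam κ t₀ φ (derivWithin φ (Ici t₀))
      (derivWithin (derivWithin φ (Ici t₀)) (Ici t₀)) (hubble (Ici t₀) γ)
      (derivWithin (hubble (Ici t₀) γ) (Ici t₀))
      (fun t => tensorNormSq (γ t) (shear (Ici t₀) γ t)) (fun t => -groupScalarCurv b (γ t)) ρ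
      (fun t => metricTrace (γ t) (S t)) := by
  have hI := uniqueDiffOn_Ici t₀
  have hn0 : n ≠ 0 := by omega
  have hγ := hsol.isMetricCurve hI
  have hx : ∀ t ∈ Ici t₀, HasDerivWithinAt φ (derivWithin φ (Ici t₀) t) (Ici t₀) t := fun t ht =>
    (hsol.contDiff_field.differentiableOn two_ne_zero t ht).hasDerivWithinAt
  refine
  { three_le := by exact_mod_cast hn
    ξ_pos := hξ
    lam_pos := hlam
    κ_pos := hκ
    deriv_x := hx
    deriv_y := fun t ht =>
      (differentiableOn_derivWithin hI hsol.contDiff_field t ht).hasDerivWithinAt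
    deriv_H := fun t ht => hγ.hasDerivWithinAt_hubble ht
    s_nonneg := fun t ht => IsMetricCurve.tensorNormSq_nonneg (hγ.posDef t ht) _
    r_nonneg := fun t ht => neg_nonneg.2 (hG _ (hγ.posDef t ht))
    ρ_nonneg := fun t ht => (Real.sqrt_nonneg _).trans (hDEC t ht).1
    abs_p_le := fun t ht => (hDEC t ht).2
    strong := hSEC
    hamiltonian := fun t ht => hsol.hamiltonianEq hn0 hI ht
    trace := fun t ht => hsol.traceEq hn0 hI ht
    field := fun t ht => hsol.fieldEq hn0 hI ht
    u_init := hφ₀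
    expanding := ?_ }
  have hn1 : (n : ℝ) - 1 ≠ 0 := by
    have : (3 : ℝ) ≤ n := by exact_mod_cast hn
    linarith
  have hu : HasDerivWithinAt (fun t => 1 - ξ * φ t ^ 2)
      (-2 * ξ * φ t₀ * derivWithin φ (Ici t₀) t₀) (Ici t₀) t₀ := by
    refine ((((hx t₀ self_mem_Ici).pow 2).const_mul ξ).const_sub 1).congr_deriv ?_
    simp
    ring
  have hlog : HasDerivWithinAt (fun t => Real.log (conformalFactor n ξ φ t))
      (conformalRate n ξ (φ t₀) (derivWithin φ (Ici t₀) t₀)) (Ici t₀) t₀ := by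
    have h1 : HasDerivWithinAt
        (fun t => 1 / ((n : ℝ) - 1) * Real.log (1 - ξ * φ t ^ 2))
        (conformalRate n ξ (φ t₀) (derivWithin φ (Ici t₀) t₀)) (Ici t₀) t₀ := by
      refine ((hu.log hφ₀.ne').const_mul (1 / ((n : ℝ) - 1))).congr_deriv ?_
      have := hφ₀.ne'
      rw [conformalRate]
      field_simp
    -- The logarithm of the power splits only where 1 - ξφ² > 0, known at this point just near `t₀`.
    refine h1.congr_of_eventuallyEq ?_ ?_
    · filter_upwards [hu.continuousWithinAt.eventually (lt_mem_nhds hφ₀)] with t ht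
      rw [conformalFactor, Real.log_rpow ht]
    · rw [conformalFactor, Real.log_rpow hφ₀]
  rw [hlog.derivWithin (hI t₀ self_mem_Ici)] at hH₀
  linarith

end IsCoupledSolution
end Reduction

end BianchiESM

end

open BianchiESM in
theorem mainTheorem1 {n : ℕ} (hn : 3 ≤ n)
    {𝔤 : Type*} [LieRing 𝔤] [LieAlgebra ℝ 𝔤] (b : Module.Basis (Fin n) ℝ 𝔤)
    (hG : ∀ h : Matrix (Fin n) (Fin n) ℝ, h.PosDef → groupScalarCurv b h ≤ 0)
    (ξ lam κ : ℝ) (hξ : 0 < ξ) (hlam : 0 < lam) (hκ : 0 < κ) (t₀ : ℝ)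
    (γ : ℝ → Matrix (Fin n) (Fin n) ℝ) (φ ρ : ℝ → ℝ) (j : ℝ → Fin n → ℝ)
    (S : ℝ → Matrix (Fin n) (Fin n) ℝ)
    (hsol : IsCoupledSolution b (Ici t₀) ξ (expPotential lam κ) γ φ ρ j S)
    (hDEC : ∀ t ∈ Ici t₀, DominantEnergy (γ t) (ρ t) (j t) (S t))
    (hSEC : ∀ t ∈ Ici t₀, StrongEnergy (γ t) (ρ t) (S t))
    (hφ₀ : 0 < 1 - ξ * φ t₀ ^ 2)
    (hH₀ : -derivWithin (fun t => Real.log (conformalFactor n ξ φ t)) (Ici t₀) t₀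
      < hubble (Ici t₀) γ t₀) :
    (∀ t ∈ Ici t₀, 0 < 1 - ξ * φ t ^ 2) ∧
    0 < 1 - ξ * fieldLimit n ξ κ ^ 2 ∧
    0 < hubbleLimit n ξ lam κ ∧
    Tendsto φ atTop (𝓝 (fieldLimit n ξ κ)) ∧
    Tendsto (derivWithin φ (Ici t₀)) atTop (𝓝 0) ∧
    Tendsto (derivWithin (derivWithin φ (Ici t₀)) (Ici t₀)) atTop (𝓝 0) ∧
    Tendsto (hubble (Ici t₀) γ) atTop (𝓝 (hubbleLimit n ξ lam κ)) ∧
    Tendsto (deceleration (Ici t₀) γ) atTop (𝓝 (-1)) ∧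
    ∀ δ : ℝ, 0 < δ →
      let decay : ℝ → ℝ := fun t => Real.exp (-(2 - δ) * hubbleLimit n ξ lam κ * t)
      (fun t => groupScalarCurv b (γ t)) =O[atTop] decay ∧
      (fun t => tensorNormSq (γ t) (shear (Ici t₀) γ t)) =O[atTop] decay ∧
      ρ =O[atTop] decay ∧
      (fun t => covectorNorm (γ t) (j t)) =O[atTop] decay ∧
      (fun t => metricTrace (γ t) (S t)) =O[atTop] decay := by
  have h := hsol.coupledSystem hn hG hξ hlam hκ hDEC hSEC hφ₀ hH₀
  have hHpos := hubbleLimit_pos hξ hlam hκ h.one_lt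
  have hle : (atTop : Filter ℝ) ≤ 𝓟 (Ici t₀) := le_principal_iff.2 (Ici_mem_atTop t₀)
  refine ⟨h.u_pos, h.limit_pos, hHpos, h.tendsto_x, h.tendsto_y, h.tendsto_z, h.tendsto_H, ?_,
    fun δ hδ => ?_⟩
  · have := (h.tendsto_Hd.div (h.tendsto_H.pow 2) (pow_ne_zero 2 hHpos.ne')).const_sub (-1)
    rw [zero_div, sub_zero] at this
    exact this
  · have hW := h.anisoEnergy_isBigO hδ
    have hρ := (h.density_isBigO.mono hle).trans hW
    refine ⟨?_, (h.shear_isBigO.mono hle).trans hW, hρ, ?_, (h.pressure_isBigO.mono hle).trans hW⟩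
    · simpa using ((h.curv_isBigO.mono hle).trans hW).neg_left
    -- The flow does not enter the scalar system; it is controlled by the density through the
    -- dominant energy condition.
    · refine IsBigO.trans (IsBigO.of_bound 1 ?_) hρ
      filter_upwards [eventually_ge_atTop t₀] with t ht
      rw [covectorNorm, Real.norm_of_nonneg (Real.sqrt_nonneg _), one_mul]
      exact (hDEC t ht).1.trans (le_abs_self _)
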